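/- Let $k\ge 1$ and let $z_1,\dots,z_n$ be a sequence of requested elements. A cache holds at most $k$ elements and is initially empty. A request to an element that is not in the cache is a \emph{miss}: the element is brought into the cache, and if the cache was full, an element is evicted. Together with the request $z_t$ an oracle supplies a real number $h_t$, a prediction of the time of the next request to the element $z_t$. All predictions are compared through a fixed linear order $\prec$ on $\{1,\dots,n\}$ with $s\prec t$ whenever $h_s<h_t$ (ties are broken in an arbitrary but fixed way). Let $H_k=\sum_{i=1}^k 1/i$. \emph{Predictive Marker} works in phases, keeping a set $M$ of marked elements and a set $S$ of possibly stale elements, both initially empty. When $z_t$ arrives and is in the cache $C$, it is marked. If $z_t\notin C$ and $|C|<k$, it is inserted and marked. Otherwise: if $|M|=k$, a new phase starts, with $S:=C$ and $M:=\emptyset$. Then an element $e\in C\setminus M$ is evicted, and $z_t$ is inserted and marked. The choice of $e$ is as follows. If $z_t\notin S$ ($z_t$ is clean), a new chain of length $1$ is started. If $z_t\in S$, then $z_t$ was evicted during the current phase and is the representative of one chain of this phase, whose length is increased by $1$. If $z_t$ is clean or the length of the chain is now at most $H_k$, then $e$ is the element of $C\setminus M$ whose most recent prediction is the latest with respect to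 $\prec$; otherwise $e$ is uniformly random in $C\setminus M$, independently of the past. In either case $e$ becomes the representative of the chain. The error $\eta_{ed}$ of the oracle is defined as follows. Let $(e,i)$ denote the $i$-th arrival of the element $e$; for $i\ge 2$ its predicted arrival time is the prediction made at the arrival $(e,i-1)$. Let $A$ be the sequence of all arrivals $(e,i)$ with $i\ge 2$ in increasing order of their true arrival times, and $B$ the sequence of the same pairs in increasing order, with respect to $\prec$, of their predicted arrival times. Then $\eta_{ed}$ is the edit distance (least number of insertions, deletions and substitutions) between $A$ and $B$. Let $\mathrm{ALG}$ be the expected number of misses of Predictive Marker and $\mathrm{OPT}$ the least number of misses of an offline schedule for $z_1,\dots,z_n$ that starts with an empty cache of size $k$. Then $$\mathrm{ALG}\le\min\Bigl(3+\frac{2\eta_{ed}}{\mathrm{OPT}},\,4H_k\Bigr)\cdot\mathrm{OPT},$$ that is, the competitive ratio is at most $\min(3+2\eta_{ed}/\mathrm{OPT},4H_k)$. The same holds if insertions into a cache that is not full are free, that is, if evictions are counted instead of misses, both for $\mathrm{ALG}$ and for $\mathrm{OPT}$. (If $\mathrm{OPT}=0$, then $\mathrm{ALG}=0$.) -/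

import Mathlib

open scoped ENNReal

noncomputable section

namespace Caching

/-- Predicted times are real numbers; ties between equal predictions are broken by a second,
integral coordinate. Comparison is lexicographic. -/
abbrev Key : Type := ℝ ×ₗ ℕ

/-- The prediction made at time `t`, together with its tie-breaking value. -/
def key {n : ℕ} (h : Fin n → ℝ) (tie : Fin n → ℕ) (t : Fin n) : Key := toLex (h t, tie t)

/-! ### Predictive Marker -/

/-- The state of Predictive Marker between two requests. -/
structure State (α : Type*) where
  /-- the cache `C` -/
  cache : Finset α
  /-- the set `M` of marked elements -/
  marked : Finset α
  /-- the set `S` of possibly stale elements: the contents of the cache when the current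
  phase began (empty in the first phase) -/
  stale : Finset α
  /-- the last prediction `p(e)` received for the element `e` -/
  pred : α → Key
  /-- `chainLen e` is the length of the clean chain of the current phase whose representative
  is `e`; every chain has exactly one representative, so that chains are named by it -/
  chainLen : α → ℕ
  /-- number of requests so far to elements that were not in the cache -/
  misses : ℕ
  /-- number of elements evicted so far -/
  evictions : ℕ

/-- The initial state: empty cache, nothing marked. -/
def State.init (α : Type*) : State α where
  cache := ∅
  marked := ∅
  stale := ∅
  pred := fun _ => toLex (0, 0)
  chainLen := fun _ => 0
  misses := 0
  evictions := 0

/-- The element of the nonempty set `U` with the highest predicted time. -/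
def argmaxPred {α : Type*} (p : α → Key) (U : Finset α) (hU : U.Nonempty) : α :=
  (U.exists_max_image p hU).choose

/-- If `k` elements are marked, a miss starts a new phase: the current cache becomes the set of
possibly stale elements and all marks are removed. -/
def State.newPhase {α : Type*} (k : ℕ) (s : State α) : State α :=
  if s.marked.card = k then { s with stale := s.cache, marked := ∅ } else s

open Classical in
/-- Length of the clean chain to which a missing element `z` belongs, once the miss is accounted
for: a clean element starts a new chain; a missing stale element is the representative of a chain,
which is extended by one. -/
def State.newLen {α : Type*} (s : State α) (z : α) : ℕ :=
  if z ∈ s.stale then s.chainLen z + 1 else 1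

open Classical in
/-- The distribution of the element evicted for the missing element `z`: if `z` is clean, or `z` is
stale and the length of its chain is at most `H_k`, the unmarked element with the highest predicted
time; otherwise a uniformly random unmarked element. (There always is an unmarked element in the
cache when this is used, so the last branch is not reached.) -/
def State.evictee {α : Type*} (k : ℕ) (s : State α) (z : α) : PMF α :=
  if hU : (s.cache \ s.marked).Nonempty then
    if z ∉ s.stale ∨ (s.newLen z : ℚ) ≤ harmonic k then
      PMF.pure (argmaxPred s.pred (s.cache \ s.marked) hU)
    else
      PMF.uniformOfFinset (s.cache \ s.marked) hU
  else PMF.pure z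

open Classical in
/-- Replace `e` by `z` in the cache, mark `z`, and make `e` the representative of the chain
of `z`. -/
def State.replace {α : Type*} (s : State α) (z e : α) : State α :=
  { s with
    cache := (insert z s.cache).erase e
    marked := insert z s.marked
    chainLen := Function.update s.chainLen e (s.newLen z)
    misses := s.misses + 1
    evictions := s.evictions + 1 }

open Classical in
/-- One round of Predictive Marker with cache size `k`: the element `z` arrives with
prediction `q`. -/
def step {α : Type*} (k : ℕ) (z : α) (q : Key) (s₀ : State α) : PMF (State α) :=
  let s : State α := { s₀ with pred := Function.update s₀.pred z q }
  if z ∈ s.cache then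
    PMF.pure { s with marked := insert z s.marked }
  else if s.cache.card < k then
    PMF.pure { s with
      cache := insert z s.cache
      marked := insert z s.marked
      misses := s.misses + 1 }
  else
    ((s.newPhase k).evictee k z).map ((s.newPhase k).replace z)

/-- The distribution of the state of Predictive Marker after serving the whole request
sequence `z`, where the prediction `h t` comes with the `t`-th request. -/
def predictiveMarker {α : Type*} (k : ℕ) {n : ℕ} (z : Fin n → α) (h : Fin n → ℝ)
    (tie : Fin n → ℕ) : PMF (State α) :=
  (List.finRange n).foldl (fun μ t => μ.bind (step k (z t) (key h tie t)))
    (PMF.pure (State.init α))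

/-- Expected value of a natural-number valued quantity. -/
def expect {S : Type*} (μ : PMF S) (f : S → ℕ) : ℝ≥0∞ := ∑' s, μ s * (f s : ℝ≥0∞)

/-! ### The offline optimum -/

/-- An offline schedule for the requests `z` with a cache of size `k`, initially empty; `C t` is the
cache just before the request at time `t` and `C (t + 1)` the one just after it. Only the requested
element may be fetched, and it must be in the cache once it has been served. -/
structure IsSchedule {α : Type*} (k : ℕ) {n : ℕ} (z : Fin n → α) (C : ℕ → Finset α) : Prop where
  zero : C 0 = ∅
  card_le : ∀ t, (C t).card ≤ k
  mem : ∀ t : Fin n, z t ∈ C (t + 1)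
  subset : ∀ t : Fin n, ∀ x ∈ C (t + 1), x = z t ∨ x ∈ C t

open Classical in
/-- Number of cache misses of a schedule. -/
def scheduleMisses {α : Type*} {n : ℕ} (z : Fin n → α) (C : ℕ → Finset α) : ℕ :=
  (Finset.univ.filter fun t : Fin n => z t ∉ C t).card

open Classical in
/-- Number of elements evicted by a schedule. -/
def scheduleEvictions {α : Type*} (n : ℕ) (C : ℕ → Finset α) : ℕ :=
  ∑ t : Fin n, (C t \ C (t + 1)).card

/-- Smallest number of cache misses of an offline schedule. -/
def optMisses {α : Type*} (k : ℕ) {n : ℕ} (z : Fin n → α) : ℕ :=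
  sInf {m | ∃ C : ℕ → Finset α, IsSchedule k z C ∧ m = scheduleMisses z C}

/-- Smallest number of evictions of an offline schedule. -/
def optEvictions {α : Type*} (k : ℕ) {n : ℕ} (z : Fin n → α) : ℕ :=
  sInf {m | ∃ C : ℕ → Finset α, IsSchedule k z C ∧ m = scheduleEvictions n C}

/-! ### The edit distance error -/

open Classical in
/-- The times before `t` at which the element requested at time `t` was requested. -/
def earlier {α : Type*} {n : ℕ} (z : Fin n → α) (t : Fin n) : Finset (Fin n) :=
  Finset.univ.filter fun s => s < t ∧ z s = z t

/-- The pair `(e, i)` such that the request at time `t` is the `i`-th arrival of `e`. -/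
def arrival {α : Type*} {n : ℕ} (z : Fin n → α) (t : Fin n) : α × ℕ :=
  (z t, (earlier z t).card + 1)

open Classical in
/-- The times, in increasing order, of the arrivals whose time is predicted, that is, of all
arrivals of elements that have arrived before (the `i`-th arrivals with `2 ≤ i`). -/
def predictedTimes {α : Type*} {n : ℕ} (z : Fin n → α) : List (Fin n) :=
  (List.finRange n).filter fun t => (earlier z t).Nonempty

/-- The prediction of the arrival at time `t`: the one made at the preceding arrival of the same
element. (The default value is not used on `predictedTimes`.) -/
def arrivalKey {α : Type*} {n : ℕ} (z : Fin n → α) (h : Fin n → ℝ) (tie : Fin n → ℕ)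
    (t : Fin n) : Key :=
  if ht : (earlier z t).Nonempty then key h tie ((earlier z t).max' ht) else key h tie t

/-- The predicted arrivals `(e, i)` in increasing order of their true arrival time. -/
def trueSeq {α : Type*} {n : ℕ} (z : Fin n → α) : List (α × ℕ) :=
  (predictedTimes z).map (arrival z)

open Classical in
/-- The same pairs `(e, i)` in increasing order of their predicted arrival time. -/
def predictedSeq {α : Type*} {n : ℕ} (z : Fin n → α) (h : Fin n → ℝ) (tie : Fin n → ℕ) :
    List (α × ℕ) :=
  ((predictedTimes z).insertionSort fun s t =>
    arrivalKey z h tie s ≤ arrivalKey z h tie t).map (arrival z)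

open Classical in
/-- The edit (Levenshtein) distance: the least number of insertions, deletions and substitutions of
single entries that turn one list into the other. -/
def editDist {β : Type*} : List β → List β → ℕ
  | [], ys => ys.length
  | _ :: xs, [] => xs.length + 1
  | x :: xs, y :: ys =>
    min (editDist xs (y :: ys) + 1)
      (min (editDist (x :: xs) ys + 1) (editDist xs ys + if x = y then 0 else 1))
termination_by xs ys => xs.length + ys.length

/-- The error of the oracle: the edit distance between the two orderings. -/
def editError {α : Type*} {n : ℕ} (z : Fin n → α) (h : Fin n → ℝ) (tie : Fin n → ℕ) : ℕ :=
  editDist (trueSeq z) (predictedSeq z h tie)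

end Caching

end

/-!
Let `L` be the number of clean requests after the first phase and `D` the number of distinct
elements. A schedule must bring in the clean requests of a phase at some time during that phase and
the one before, so every unit of its cost is charged at most twice and `L ≤ 2 OPT`.

Every miss in a full cache starts a chain (at a clean request) or extends one. Give a chain a
potential that depends on the rank `r` of its representative, the number of unmarked elements that
arrive after it. A random eviction makes the new rank uniform on `{0, …, r - 1}`, so that `H_r`
drops by one on average, and at most `H_k` evictions are made by prediction; hence a chain has at
most `2 H_k` expected evictions.

If the edit distance is `η`, the predictions are in the right order on a set `K` that contains all
but `η` of the predicted arrivals. While a chain evicts by prediction, its representatives arrive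
at increasing times that are predicted to be decreasing, so at most one of these arrivals is in
`K`. Every other one is charged `2` to the error, enough to pay also for the random part of the
chain, and evicted elements that never arrive again are at most `D - k`.
-/

noncomputable section

namespace Caching

open Finset
open scoped Classical ENNReal

/-! ### Expectations and Markov chains -/

section Mean

variable {S T : Type*}

/-- The expected value of the nonnegative function `f` under `μ`. It extends `expect` from natural
numbers to the potentials of the analysis. -/
def mean (μ : PMF S) (f : S → ℝ≥0∞) : ℝ≥0∞ := ∑' s, μ s * f s

theorem mean_pure (s : S) (f : S → ℝ≥0∞) : mean (PMF.pure s) f = f s := by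
  rw [mean, tsum_eq_single s fun b hb => by simp [PMF.pure_apply, hb]]
  simp

theorem mean_bind (μ : PMF S) (κ : S → PMF T) (f : T → ℝ≥0∞) :
    mean (μ.bind κ) f = mean μ fun s => mean (κ s) f := by
  simp only [mean, PMF.bind_apply, ← ENNReal.tsum_mul_right, ← ENNReal.tsum_mul_left]
  rw [ENNReal.tsum_comm]
  simp only [mul_assoc]

theorem mean_map (μ : PMF S) (g : S → T) (f : T → ℝ≥0∞) :
    mean (μ.map g) f = mean μ (f ∘ g) := by
  rw [← PMF.bind_pure_comp, mean_bind]
  simp only [Function.comp_apply, mean_pure, Function.comp_def]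

theorem mean_mono {μ : PMF S} {f g : S → ℝ≥0∞} (hfg : ∀ s ∈ μ.support, f s ≤ g s) :
    mean μ f ≤ mean μ g := by
  refine ENNReal.tsum_le_tsum fun s => ?_
  by_cases hs : μ s = 0
  · simp [hs]
  · gcongr
    exact hfg s ((PMF.mem_support_iff μ s).2 hs)

theorem mean_add_const (μ : PMF S) (f : S → ℝ≥0∞) (c : ℝ≥0∞) :
    mean μ (fun s => f s + c) = mean μ f + c := by
  simp only [mean, mul_add, ENNReal.tsum_add, ENNReal.tsum_mul_right, μ.tsum_coe, one_mul]

theorem mean_uniformOfFinset {U : Finset S} (hU : U.Nonempty) (f : S → ℝ≥0∞) :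
    mean (PMF.uniformOfFinset U hU) f = (#U : ℝ≥0∞)⁻¹ * ∑ e ∈ U, f e := by
  rw [mean, tsum_eq_sum (s := U) fun e he => by
    rw [PMF.uniformOfFinset_apply_of_notMem hU he, zero_mul], mul_sum]
  exact sum_congr rfl fun e he => by rw [PMF.uniformOfFinset_apply_of_mem hU he]

theorem mean_uniformOfFinset_ofReal_le {U : Finset S} (hU : U.Nonempty) {f : S → ℝ}
    (hf : ∀ e ∈ U, 0 ≤ f e) {B : ℝ} (hB : ∑ e ∈ U, f e ≤ #U * B) :
    mean (PMF.uniformOfFinset U hU) (fun e => ENNReal.ofReal (f e)) ≤ ENNReal.ofReal B := by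
  have hcard : (0 : ℝ) < #U := by exact_mod_cast hU.card_pos
  rw [mean_uniformOfFinset, ← ENNReal.ofReal_sum_of_nonneg hf, ← ENNReal.ofReal_natCast,
    ← ENNReal.ofReal_inv_of_pos hcard, ← ENNReal.ofReal_mul (by positivity)]
  exact ENNReal.ofReal_le_ofReal ((inv_mul_le_iff₀ hcard).2 hB)

theorem foldl_finRange_induction {β : Type*} {n : ℕ} {P : ℕ → β → Prop} {f : β → Fin n → β} {b : β}
    (zero : P 0 b) (succ : ∀ (t : Fin n) (b : β), P t b → P (t + 1) (f b t)) :
    P n ((List.finRange n).foldl f b) := by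
  induction n with
  | zero => simpa using zero
  | succ n ih =>
    rw [List.finRange_succ_last, List.foldl_append, List.foldl_map]
    exact succ (Fin.last n) _ (ih fun t b => succ t.castSucc b)

theorem forall_mem_support_bind {μ : PMF S} {κ : S → PMF T} {I : S → Prop} {J : T → Prop}
    (hμ : ∀ s ∈ μ.support, I s) (hκ : ∀ s, I s → ∀ s' ∈ (κ s).support, J s') :
    ∀ s' ∈ (μ.bind κ).support, J s' := by
  intro s' hs'
  obtain ⟨s, hs, hss'⟩ := (PMF.mem_support_bind_iff _ _ _).1 hs'
  exact hκ s (hμ s hs) s' hss'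

variable {n : ℕ} {κ : Fin n → S → PMF S} {I : ℕ → S → Prop} {s₀ : S}

theorem forall_mem_support_foldl_bind (zero : I 0 s₀)
    (succ : ∀ (t : Fin n) (s : S), I t s → ∀ s' ∈ (κ t s).support, I (t + 1) s') :
    ∀ s ∈ ((List.finRange n).foldl (fun μ t => μ.bind (κ t)) (PMF.pure s₀)).support, I n s :=
  foldl_finRange_induction (P := fun t (μ : PMF S) => ∀ s ∈ μ.support, I t s)
    (by simpa using zero) fun t _ hμ => forall_mem_support_bind hμ (succ t)

theorem mean_foldl_bind_le (zero : I 0 s₀)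
    (succ : ∀ (t : Fin n) (s : S), I t s → ∀ s' ∈ (κ t s).support, I (t + 1) s')
    {Φ : ℕ → S → ℝ≥0∞}
    (drift : ∀ (t : Fin n) (s : S), I t s → mean (κ t s) (Φ (t + 1)) ≤ Φ t s) :
    mean ((List.finRange n).foldl (fun μ t => μ.bind (κ t)) (PMF.pure s₀)) (Φ n) ≤ Φ 0 s₀ := by
  refine (foldl_finRange_induction
    (P := fun t (μ : PMF S) => (∀ s ∈ μ.support, I t s) ∧ mean μ (Φ t) ≤ Φ 0 s₀) ?_ ?_).2
  · exact ⟨by simpa using zero, (mean_pure s₀ _).le⟩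
  · rintro t μ ⟨hI, hΦ⟩
    refine ⟨forall_mem_support_bind hI (succ t), ?_⟩
    rw [mean_bind]
    exact (mean_mono fun s hs => drift t s (hI s hs)).trans hΦ

end Mean

/-! ### The edit distance and correctly ordered arrivals -/

theorem exists_common_sublist {β : Type*} (xs ys : List β) :
    ∃ l : List β, l.Sublist xs ∧ l.Sublist ys ∧ xs.length ≤ l.length + editDist xs ys := by
  induction xs, ys using editDist.induct with
  | case1 ys => exact ⟨[], by simp, by simp, by simp⟩
  | case2 x xs => exact ⟨[], by simp, by simp, by simp [editDist]⟩
  | case3 x xs y ys deletion insertion substitution =>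
    obtain ⟨l₁, hx₁, hy₁, h₁⟩ := deletion
    obtain ⟨l₂, hx₂, hy₂, h₂⟩ := insertion
    obtain ⟨l₃, hx₃, hy₃, h₃⟩ := substitution
    simp only [List.length_cons] at h₂ ⊢
    by_cases hdel : editDist (x :: xs) (y :: ys) = editDist xs (y :: ys) + 1
    · exact ⟨l₁, hx₁.cons x, hy₁, by omega⟩
    by_cases hins : editDist (x :: xs) (y :: ys) = editDist (x :: xs) ys + 1
    · exact ⟨l₂, hx₂, hy₂.cons y, by omega⟩
    rw [editDist] at hdel hins ⊢
    by_cases hxy : x = y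
    · subst hxy
      exact ⟨x :: l₃, hx₃.cons_cons x, hy₃.cons_cons x, by grind⟩
    · exact ⟨l₃, hx₃.cons x, hy₃.cons y, by grind⟩

theorem monotoneOn_of_pairwise {β γ : Type*} [Preorder β] [Preorder γ] {f : β → γ} {l : List β}
    (hl : l.Pairwise (· < ·)) (hf : l.Pairwise (f · ≤ f ·)) : MonotoneOn f {x | x ∈ l} := by
  have hle : l.Pairwise fun x y => x ≤ y → f x ≤ f y :=
    hf.imp (S := fun x y => x ≤ y → f x ≤ f y) fun h _ => h
  have hge : l.Pairwise (flip fun x y => x ≤ y → f x ≤ f y) :=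
    hl.imp fun h h' => (h.not_ge h').elim
  exact fun x hx y hy => hle.forall_of_forall_of_flip (fun _ _ _ => le_rfl) hge hx hy

section Arrivals

variable {α : Type*} {n : ℕ} {z : Fin n → α} {h : Fin n → ℝ} {tie : Fin n → ℕ} {s t : Fin n}

theorem mem_earlier : s ∈ earlier z t ↔ s < t ∧ z s = z t := by
  simp [earlier]

theorem card_earlier_lt (hst : s < t) (hz : z s = z t) : #(earlier z s) < #(earlier z t) := by
  refine card_lt_card (ssubset_iff_of_subset (fun i hi => ?_) |>.2 ⟨s, ?_, ?_⟩)
  · rw [mem_earlier] at hi ⊢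
    exact ⟨hi.1.trans hst, hi.2.trans hz⟩
  · exact mem_earlier.2 ⟨hst, hz⟩
  · simp [mem_earlier]

theorem arrival_injective (z : Fin n → α) : Function.Injective (arrival z) := by
  intro s t hst
  obtain ⟨hz, hcard⟩ := Prod.mk.inj hst
  by_contra hne
  rcases lt_or_gt_of_ne hne with hlt | hlt
  · have := card_earlier_lt hlt hz
    omega
  · have := card_earlier_lt hlt hz.symm
    omega

theorem arrivalKey_eq_key (hst : s ∈ earlier z t) (hlast : ∀ i ∈ earlier z t, i ≤ s) :
    arrivalKey z h tie t = key h tie s := by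
  rw [arrivalKey, dif_pos ⟨s, hst⟩]
  congr
  exact le_antisymm (max'_le _ _ _ hlast) (le_max' _ _ hst)

theorem arrivalKey_injOn (z : Fin n → α) (h : Fin n → ℝ) (htie : Function.Injective tie) :
    Set.InjOn (arrivalKey z h tie) {t | (earlier z t).Nonempty} := by
  intro s hs t ht hst
  rw [Set.mem_ofPred_eq] at hs ht
  rw [arrivalKey, arrivalKey, dif_pos hs, dif_pos ht] at hst
  have hmax : (earlier z s).max' hs = (earlier z t).max' ht :=
    htie (congrArg (fun q : Key => (ofLex q).2) hst)
  obtain ⟨hs_lt, hzs⟩ := mem_earlier.1 (max'_mem _ hs)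
  obtain ⟨ht_lt, hzt⟩ := mem_earlier.1 (max'_mem _ ht)
  have hz : z s = z t := by rw [← hzs, hmax, hzt]
  by_contra hne
  rcases lt_or_gt_of_ne hne with hlt | hlt
  · have := le_max' _ s (mem_earlier.2 ⟨hlt, hz⟩)
    exact (hmax ▸ hs_lt).not_ge this
  · have := le_max' _ t (mem_earlier.2 ⟨hlt, hz.symm⟩)
    exact (hmax ▸ ht_lt).not_ge this

theorem exists_strictMonoOn_arrivalKey (z : Fin n → α) (h : Fin n → ℝ)
    (htie : Function.Injective tie) :
    ∃ K : Finset (Fin n), StrictMonoOn (arrivalKey z h tie) K ∧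
      #{t | t ∉ K ∧ (earlier z t).Nonempty} ≤ editError z h tie := by
  obtain ⟨l, hl_true, hl_pred, hcard⟩ := exists_common_sublist (trueSeq z) (predictedSeq z h tie)
  obtain ⟨l₁, hl₁, rfl⟩ := List.sublist_map_iff.1 hl_true
  obtain ⟨l₂, hl₂, hmap⟩ := List.sublist_map_iff.1 hl_pred
  obtain rfl : l₁ = l₂ := List.map_injective_iff.2 (arrival_injective z) hmap
  have hlt : l₁.Pairwise (· < ·) :=
    (List.pairwise_lt_finRange n).sublist (hl₁.trans List.filter_sublist)
  have hle : l₁.Pairwise (arrivalKey z h tie · ≤ arrivalKey z h tie ·) := by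
    have : IsTrans (Fin n) (arrivalKey z h tie · ≤ arrivalKey z h tie ·) := ⟨fun _ _ _ => le_trans⟩
    have : Std.Total (arrivalKey z h tie · ≤ arrivalKey z h tie ·) := ⟨fun _ _ => le_total _ _⟩
    exact (List.pairwise_insertionSort _ _).sublist hl₂
  have hrec : ∀ t ∈ l₁, (earlier z t).Nonempty := fun t ht => by
    simpa [predictedTimes] using hl₁.subset ht
  refine ⟨l₁.toFinset, ?_, ?_⟩
  · rw [List.coe_toFinset]
    exact (monotoneOn_of_pairwise hlt hle).strictMonoOn_of_injOn
      ((arrivalKey_injOn z h htie).mono hrec)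
  · have hsdiff : ({t | t ∉ l₁.toFinset ∧ (earlier z t).Nonempty} : Finset (Fin n)) =
        (predictedTimes z).toFinset \ l₁.toFinset := by
      ext t
      simp [predictedTimes, and_comm]
    have hsub : l₁.toFinset ⊆ (predictedTimes z).toFinset := fun t ht =>
      List.mem_toFinset.2 (hl₁.subset (List.mem_toFinset.1 ht))
    have hnodup : (predictedTimes z).Nodup := (List.nodup_finRange n).filter _
    rw [hsdiff, card_sdiff_of_subset hsub, List.toFinset_card_of_nodup hnodup,
      List.toFinset_card_of_nodup (hlt.imp ne_of_lt), editError]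
    simp only [trueSeq, List.length_map] at hcard ⊢
    omega

end Arrivals

/-! ### Next arrivals -/

section NextArrival

variable {α : Type*} {n : ℕ} {z : Fin n → α} {h : Fin n → ℝ} {tie : Fin n → ℕ}

/-- The time of the first request to `x` at time `t` or later, where `n` stands for "never". -/
def nextArrival (z : Fin n → α) (t : ℕ) (x : α) : ℕ :=
  sInf {τ | t ≤ τ ∧ ∀ hτ : τ < n, z ⟨τ, hτ⟩ = x}

/-- The element `x` is requested before time `t`. -/
def RequestedBefore (z : Fin n → α) (t : ℕ) (x : α) : Prop :=
  ∃ i : Fin n, i < t ∧ z i = x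

/-- The predictions `p` stored at time `t` are the ones that the error of the oracle compares with
the next arrivals. -/
def PredictionsCurrent (z : Fin n → α) (h : Fin n → ℝ) (tie : Fin n → ℕ) (t : ℕ) (p : α → Key) :
    Prop :=
  ∀ x, RequestedBefore z t x → ∀ hx : nextArrival z t x < n,
    p x = arrivalKey z h tie ⟨nextArrival z t x, hx⟩

/-- The arrival at time `τ` is predicted no later than the one at time `τ'`. Since nothing is
predicted about elements that never return, times beyond the last request satisfy this relation
with every time. -/
def PredictedLE (z : Fin n → α) (h : Fin n → ℝ) (tie : Fin n → ℕ) (τ τ' : ℕ) : Prop :=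
  ∀ (hτ : τ < n) (hτ' : τ' < n), arrivalKey z h tie ⟨τ, hτ⟩ ≤ arrivalKey z h tie ⟨τ', hτ'⟩

section

variable {t : ℕ} {x y : α}

theorem nextArrival_mem (ht : t ≤ n) :
    nextArrival z t x ∈ {τ | t ≤ τ ∧ ∀ hτ : τ < n, z ⟨τ, hτ⟩ = x} :=
  Nat.sInf_mem ⟨n, ht, fun hn => (lt_irrefl n hn).elim⟩

theorem le_nextArrival (ht : t ≤ n) : t ≤ nextArrival z t x := (nextArrival_mem ht).1

theorem apply_nextArrival (ht : t ≤ n) (hx : nextArrival z t x < n) :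
    z ⟨nextArrival z t x, hx⟩ = x := (nextArrival_mem ht).2 hx

theorem nextArrival_le (ht : t ≤ n) : nextArrival z t x ≤ n :=
  Nat.sInf_le ⟨ht, fun hn => (lt_irrefl n hn).elim⟩

theorem nextArrival_le_of_eq {τ : Fin n} (ht : t ≤ τ) (hx : z τ = x) : nextArrival z t x ≤ τ :=
  Nat.sInf_le ⟨ht, fun _ => hx⟩

theorem nextArrival_inj (ht : t ≤ n) (hx : nextArrival z t x < n)
    (hxy : nextArrival z t x = nextArrival z t y) : x = y := by
  rw [← apply_nextArrival ht hx, ← apply_nextArrival ht (hxy ▸ hx : nextArrival z t y < n)]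
  congr 2

end

variable {t : Fin n} {x : α}

theorem nextArrival_self (t : Fin n) : nextArrival z t (z t) = t :=
  le_antisymm (nextArrival_le_of_eq le_rfl rfl) (le_nextArrival t.2.le)

theorem nextArrival_succ (hx : x ≠ z t) : nextArrival z (t + 1) x = nextArrival z t x := by
  unfold nextArrival
  congr 1
  ext τ
  refine and_congr_left fun hτ => ⟨Nat.le_of_succ_le, fun hle => hle.lt_of_ne ?_⟩
  rintro rfl
  exact hx (hτ t.2).symm

theorem RequestedBefore.succ {t : ℕ} (hx : RequestedBefore z t x) : RequestedBefore z (t + 1) x :=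
  hx.imp fun _ => And.imp_left Nat.lt_succ_of_lt

theorem RequestedBefore.of_succ (hx : RequestedBefore z (t + 1) x) (hne : x ≠ z t) :
    RequestedBefore z t x := by
  obtain ⟨i, hi, rfl⟩ := hx
  exact ⟨i, (Nat.le_of_lt_succ hi).lt_of_ne fun hit => hne (congrArg z (Fin.ext hit)), rfl⟩

theorem arrivalKey_nextArrival_succ (hx : nextArrival z (t + 1) (z t) < n) :
    arrivalKey z h tie ⟨nextArrival z (t + 1) (z t), hx⟩ = key h tie t := by
  have hz := apply_nextArrival t.2 hx
  refine arrivalKey_eq_key (mem_earlier.2 ⟨le_nextArrival t.2, hz.symm⟩) fun i hi => ?_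
  obtain ⟨hi_lt, hi_eq⟩ := mem_earlier.1 hi
  by_contra hti
  exact (nextArrival_le_of_eq (not_le.1 hti) (hi_eq.trans hz)).not_gt hi_lt

theorem PredictionsCurrent.update {p : α → Key} (hp : PredictionsCurrent z h tie t p) :
    PredictionsCurrent z h tie (t + 1) (Function.update p (z t) (key h tie t)) := by
  intro x hreq hx
  by_cases hxz : x = z t
  · subst hxz
    rw [Function.update_self, arrivalKey_nextArrival_succ]
  · simp only [Function.update_of_ne hxz, nextArrival_succ hxz] at hx ⊢
    exact hp x (hreq.of_succ hxz) hx

theorem predictionsCurrent_zero (p : α → Key) : PredictionsCurrent z h tie 0 p := by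
  rintro x ⟨i, hi, -⟩
  exact (Nat.not_lt_zero _ hi).elim

end NextArrival

/-! ### Ranks of unmarked elements -/

section Rank

variable {α : Type*} {n : ℕ} {z : Fin n → α} {t : ℕ} {U V : Finset α} {e x : α}

/-- The number of elements of `U` that next arrive after `e`. -/
def rank (z : Fin n → α) (t : ℕ) (U : Finset α) (e : α) : ℕ :=
  #{x ∈ U | nextArrival z t e < nextArrival z t x}

theorem rank_mono (hUV : U ⊆ V) (e : α) : rank z t U e ≤ rank z t V e :=
  card_le_card (filter_subset_filter _ hUV)

theorem rank_lt (he : e ∈ U) : rank z t U e < #U :=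
  card_lt_card (filter_ssubset.2 ⟨e, he, lt_irrefl _⟩)

theorem rank_succ {t : Fin n} (hU : z t ∉ U) (he : e ≠ z t) :
    rank z (t + 1) U e = rank z t U e := by
  refine congrArg card (filter_congr fun x hx => ?_)
  rw [nextArrival_succ he, nextArrival_succ (ne_of_mem_of_not_mem hx hU)]

theorem rank_requested {t : Fin n} (hU : z t ∉ U) : rank z t U (z t) = #U := by
  refine congrArg card (filter_true_of_mem fun x hx => ?_)
  rw [nextArrival_self]
  refine (le_nextArrival t.2.le).lt_of_ne fun heq => ?_
  have hzx : z t = x :=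
    nextArrival_inj t.2.le ((nextArrival_self t).trans_lt t.2) ((nextArrival_self t).trans heq)
  exact hU (hzx ▸ hx)

theorem rank_lt_rank (hx : x ∈ U) (hlt : nextArrival z t e < nextArrival z t x) :
    rank z t U x < rank z t U e := by
  refine card_lt_card (ssubset_iff_of_subset (fun y hy => ?_) |>.2
    ⟨x, mem_filter.2 ⟨hx, hlt⟩, by simp⟩)
  rw [mem_filter] at hy ⊢
  exact ⟨hy.1, hlt.trans hy.2⟩

theorem rank_injOn (ht : t ≤ n) : Set.InjOn (rank z t U) {e ∈ U | nextArrival z t e < n} := by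
  rintro e ⟨he, hen⟩ x ⟨hx, -⟩ hex
  rcases lt_trichotomy (nextArrival z t e) (nextArrival z t x) with hlt | heq | hlt
  · exact ((rank_lt_rank hx hlt).ne' hex).elim
  · exact nextArrival_inj ht hen heq
  · exact ((rank_lt_rank he hlt).ne hex).elim

theorem sum_rank_le (ht : t ≤ n) {g : ℕ → ℝ} (hg : ∀ j, 0 ≤ g j) :
    ∑ e ∈ U with nextArrival z t e < n, g (rank z t U e) ≤ ∑ j ∈ range #U, g j := by
  rw [← sum_image (f := g) fun e he x hx => rank_injOn ht (by simpa using he) (by simpa using hx)]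
  refine sum_le_sum_of_subset_of_nonneg (fun j hj => ?_) fun j _ _ => hg j
  obtain ⟨e, he, rfl⟩ := mem_image.1 hj
  exact mem_range.2 (rank_lt (mem_filter.1 he).1)

end Rank

/-! ### Clean requests -/

section Clean

variable {α : Type*} {k n : ℕ} {z : Fin n → α} {M S : Finset α}

/-- The number of requests to clean elements after the first phase, when `M` is the set of elements
requested in the current phase and `S` the set of those requested in the phase before. -/
def cleanCount (k : ℕ) : List α → Finset α → Finset α → ℕ
  | [], _, _ => 0
  | x :: l, M, S =>
    if x ∈ M then cleanCount k l M S
    else if #M = k then 1 + cleanCount k l {x} M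
    else (if S.Nonempty ∧ x ∉ S then 1 else 0) + cleanCount k l (insert x M) S

/-- `cleanCount` for the requests from time `t` on. -/
def cleanFrom (k : ℕ) (z : Fin n → α) (t : ℕ) (M S : Finset α) : ℕ :=
  cleanCount k (((List.finRange n).drop t).map z) M S

theorem cleanFrom_of_le {t : ℕ} (ht : n ≤ t) : cleanFrom k z t M S = 0 := by
  rw [cleanFrom, List.drop_of_length_le (by simpa using ht), List.map_nil, cleanCount]

theorem cleanFrom_eq (t : Fin n) : cleanFrom k z t M S =
    if z t ∈ M then cleanFrom k z (t + 1) M S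
    else if #M = k then 1 + cleanFrom k z (t + 1) {z t} M
    else (if S.Nonempty ∧ z t ∉ S then 1 else 0) + cleanFrom k z (t + 1) (insert (z t) M) S := by
  unfold cleanFrom
  rw [List.drop_eq_getElem_cons (by simp), List.map_cons, cleanCount]
  simp

end Clean

/-! ### One round of Predictive Marker -/

section Step

variable {α : Type*} {k : ℕ} {s : State α} {x e : α} {q : Key}

/-- The element `x` arrives with prediction `q`. -/
def State.learn (s : State α) (x : α) (q : Key) : State α :=
  { s with pred := Function.update s.pred x q }

/-- A request to the cached element `x` is served. -/
def State.mark (s : State α) (x : α) : State α := { s with marked := insert x s.marked }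

/-- A request to the missing element `x` is served without an eviction. -/
def State.fetch (s : State α) (x : α) : State α :=
  { s with cache := insert x s.cache, marked := insert x s.marked, misses := s.misses + 1 }

/-- The candidates for an eviction. -/
def State.unmarked (s : State α) : Finset α := s.cache \ s.marked

/-- The representatives of the chains of the current phase. -/
def State.representatives (s : State α) : Finset α := s.stale \ s.cache

theorem step_of_mem (hx : x ∈ s.cache) : step k x q s = PMF.pure ((s.learn x q).mark x) :=
  if_pos hx

theorem step_of_card_lt (hx : x ∉ s.cache) (hs : #s.cache < k) :
    step k x q s = PMF.pure ((s.learn x q).fetch x) :=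
  (if_neg hx).trans (if_pos hs)

theorem step_of_le_card (hx : x ∉ s.cache) (hs : k ≤ #s.cache) :
    step k x q s = (((s.learn x q).newPhase k).evictee k x).map
      (((s.learn x q).newPhase k).replace x) :=
  (if_neg hx).trans (if_neg hs.not_gt)

theorem newPhase_of_card_eq (hs : #s.marked = k) :
    s.newPhase k = { s with stale := s.cache, marked := ∅ } := if_pos hs

theorem newPhase_of_card_ne (hs : #s.marked ≠ k) : s.newPhase k = s := if_neg hs

theorem newPhase_cache : (s.newPhase k).cache = s.cache := by
  rw [State.newPhase, apply_ite State.cache, ite_self]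

theorem newPhase_pred : (s.newPhase k).pred = s.pred := by
  rw [State.newPhase, apply_ite State.pred, ite_self]

theorem newLen_of_mem (hx : x ∈ s.stale) : s.newLen x = s.chainLen x + 1 := if_pos hx

theorem newLen_of_notMem (hx : x ∉ s.stale) : s.newLen x = 1 := if_neg hx

theorem one_le_newLen : 1 ≤ s.newLen x := by
  unfold State.newLen
  split_ifs <;> omega

theorem unmarked_mark : (s.mark x).unmarked = s.unmarked.erase x :=
  sdiff_insert _ _ _

theorem unmarked_replace (hx : x ∉ s.cache) : (s.replace x e).unmarked = s.unmarked.erase e := by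
  ext y
  simp only [State.unmarked, State.replace, mem_sdiff, mem_erase, mem_insert]
  grind

theorem representatives_replace (he : e ∈ s.stale) :
    (s.replace x e).representatives = insert e (s.representatives.erase x) := by
  ext y
  simp only [State.representatives, State.replace, mem_sdiff, mem_erase, mem_insert]
  grind

theorem chainLen_replace_self : (s.replace x e).chainLen e = s.newLen x := by
  simp only [State.replace, Function.update_self]

theorem chainLen_replace_of_ne {y : α} (hy : y ≠ e) : (s.replace x e).chainLen y = s.chainLen y :=
  Function.update_of_ne hy ..

theorem argmaxPred_mem (p : α → Key) {U : Finset α} (hU : U.Nonempty) : argmaxPred p U hU ∈ U :=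
  (U.exists_max_image p hU).choose_spec.1

theorem le_argmaxPred (p : α → Key) {U : Finset α} (hU : U.Nonempty) (hx : x ∈ U) :
    p x ≤ p (argmaxPred p U hU) :=
  (U.exists_max_image p hU).choose_spec.2 x hx

/-- The greatest length of a chain whose representative is chosen by prediction. -/
def detLen (k : ℕ) : ℕ := ⌊harmonic k⌋₊

theorem natCast_le_harmonic_iff {m : ℕ} : (m : ℚ) ≤ harmonic k ↔ m ≤ detLen k :=
  (Nat.le_floor_iff (sum_nonneg fun _ _ => by positivity)).symm

theorem evictee_eq_pure (hU : s.unmarked.Nonempty) (hx : x ∉ s.stale ∨ s.newLen x ≤ detLen k) :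
    s.evictee k x = PMF.pure (argmaxPred s.pred s.unmarked hU) := by
  rw [← natCast_le_harmonic_iff] at hx
  exact (dif_pos hU).trans (if_pos hx)

theorem evictee_eq_uniform (hU : s.unmarked.Nonempty) (hx : x ∈ s.stale)
    (hlen : detLen k < s.newLen x) : s.evictee k x = PMF.uniformOfFinset s.unmarked hU := by
  rw [← not_le, ← natCast_le_harmonic_iff] at hlen
  exact (dif_pos hU).trans (if_neg (by tauto))

theorem evictee_cases (hU : s.unmarked.Nonempty) :
    ((x ∉ s.stale ∨ s.newLen x ≤ detLen k) ∧
      s.evictee k x = PMF.pure (argmaxPred s.pred s.unmarked hU)) ∨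
    ((x ∈ s.stale ∧ detLen k < s.newLen x) ∧
      s.evictee k x = PMF.uniformOfFinset s.unmarked hU) := by
  by_cases hx : x ∉ s.stale ∨ s.newLen x ≤ detLen k
  · exact Or.inl ⟨hx, evictee_eq_pure hU hx⟩
  · push Not at hx
    exact Or.inr ⟨hx, evictee_eq_uniform hU hx.1 hx.2⟩

theorem mem_unmarked_of_mem_support_evictee (hU : s.unmarked.Nonempty)
    (he : e ∈ (s.evictee k x).support) : e ∈ s.unmarked := by
  rcases evictee_cases (k := k) (x := x) hU with ⟨-, heq⟩ | ⟨-, heq⟩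
  · rw [heq, PMF.mem_support_pure_iff] at he
    exact he ▸ argmaxPred_mem s.pred hU
  · rwa [heq, PMF.mem_support_uniformOfFinset_iff] at he

theorem pred_le_of_mem_support_evictee (he : e ∈ (s.evictee k x).support)
    (hlen : s.newLen x ≤ detLen k) {y : α} (hy : y ∈ s.unmarked) : s.pred y ≤ s.pred e := by
  rw [evictee_eq_pure ⟨y, hy⟩ (Or.inr hlen), PMF.mem_support_pure_iff] at he
  exact he ▸ le_argmaxPred s.pred ⟨y, hy⟩ hy

end Step

/-! ### Invariants -/

section Invariant

variable {α : Type*} {k n : ℕ} {z : Fin n → α} {h : Fin n → ℝ} {tie : Fin n → ℕ}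

/-- Properties of the cache, the marks and the chains that hold before the request at time `t`. -/
structure Invariant (k : ℕ) (z : Fin n → α) (h : Fin n → ℝ) (tie : Fin n → ℕ) (t : ℕ)
    (s : State α) : Prop where
  card_cache_le : #s.cache ≤ k
  marked_subset : s.marked ⊆ s.cache
  cache_subset : s.cache ⊆ s.marked ∪ s.stale
  full : #s.cache = k ∨ s.stale = ∅
  requested : ∀ x ∈ s.cache ∪ s.stale, RequestedBefore z t x
  one_le_chainLen : ∀ e ∈ s.representatives, 1 ≤ s.chainLen e
  chainLen_le : ∀ e ∈ s.representatives, s.chainLen e ≤ #s.marked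
  predictedLE : ∀ e ∈ s.representatives, s.chainLen e ≤ detLen k → ∀ x ∈ s.unmarked,
    PredictedLE z h tie (nextArrival z t x) (nextArrival z t e)
  misses_eq : s.misses = s.evictions + #s.cache

namespace Invariant

variable {t : Fin n} {s : State α} {e : α}

theorem init (k : ℕ) (z : Fin n → α) (h : Fin n → ℝ) (tie : Fin n → ℕ) :
    Invariant k z h tie 0 (State.init α) := by
  constructor <;> simp [State.init, State.representatives]

theorem learn {t : ℕ} (hs : Invariant k z h tie t s) (x : α) (q : Key) :
    Invariant k z h tie t (s.learn x q) :=
  { hs with }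

theorem marked_eq_cache {t : ℕ} (hs : Invariant k z h tie t s) (hS : s.stale = ∅) :
    s.marked = s.cache :=
  hs.marked_subset.antisymm (by simpa [hS] using hs.cache_subset)

theorem unmarked_subset_stale {t : ℕ} (hs : Invariant k z h tie t s) : s.unmarked ⊆ s.stale :=
  sdiff_le_iff.2 hs.cache_subset

theorem newLen_le {t : ℕ} {x : α} (hs : Invariant k z h tie t s) (hx : x ∉ s.cache) :
    s.newLen x ≤ #s.marked + 1 := by
  by_cases hxS : x ∈ s.stale
  · rw [newLen_of_mem hxS]
    exact Nat.succ_le_succ (hs.chainLen_le x (mem_sdiff.2 ⟨hxS, hx⟩))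
  · rw [newLen_of_notMem hxS]
    omega

theorem requested_insert {t : Fin n} (hs : Invariant k z h tie t s) :
    ∀ x ∈ insert (z t) (s.cache ∪ s.stale), RequestedBefore z (t + 1) x := by
  intro x hx
  rcases mem_insert.1 hx with rfl | hx
  · exact ⟨t, Nat.lt_succ_self t, rfl⟩
  · exact (hs.requested x hx).succ

theorem mark (hs : Invariant k z h tie t s) (hz : z t ∈ s.cache) :
    Invariant k z h tie (t + 1) (s.mark (z t)) where
  card_cache_le := hs.card_cache_le
  marked_subset := insert_subset hz hs.marked_subset
  cache_subset := hs.cache_subset.trans (union_subset_union_left (subset_insert _ _))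
  full := hs.full
  requested x hx := hs.requested_insert x (mem_insert_of_mem hx)
  one_le_chainLen := hs.one_le_chainLen
  chainLen_le e he := (hs.chainLen_le e he).trans (card_le_card (subset_insert _ _))
  predictedLE e he hlen x hx := by
    rw [unmarked_mark, mem_erase] at hx
    rw [nextArrival_succ hx.1, nextArrival_succ (ne_of_mem_of_not_mem hz (mem_sdiff.1 he).2).symm]
    exact hs.predictedLE e he hlen x hx.2
  misses_eq := hs.misses_eq

theorem fetch (hs : Invariant k z h tie t s) (hz : z t ∉ s.cache) (hc : #s.cache < k) :
    Invariant k z h tie (t + 1) (s.fetch (z t)) := by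
  have hS : s.stale = ∅ := hs.full.resolve_left hc.ne
  have hreq := hs.requested_insert
  have hmiss := hs.misses_eq
  constructor <;>
    simp_all [State.fetch, State.representatives, hs.marked_eq_cache hS, Nat.succ_le_iff, add_assoc]

theorem newPhase {t : ℕ} (hs : Invariant k z h tie t s) (hc : #s.cache = k) :
    Invariant k z h tie t (s.newPhase k) := by
  by_cases hm : #s.marked = k
  · rw [newPhase_of_card_eq hm]
    have hreq := fun x hx => hs.requested x (mem_union_left _ hx)
    constructor <;> simp_all [State.representatives, hs.misses_eq]
  · rwa [newPhase_of_card_ne hm]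

theorem card_marked_newPhase_lt {t : ℕ} (hs : Invariant k z h tie t s) (hk : 0 < k) :
    #(s.newPhase k).marked < k := by
  by_cases hm : #s.marked = k
  · rwa [newPhase_of_card_eq hm, card_empty]
  · rw [newPhase_of_card_ne hm]
    exact ((card_le_card hs.marked_subset).trans hs.card_cache_le).lt_of_ne hm

theorem replace (hs : Invariant k z h tie t s) (hz : z t ∉ s.cache) (hc : #s.cache = k)
    (he : e ∈ s.unmarked)
    (hpred : s.newLen (z t) ≤ detLen k → ∀ x ∈ s.unmarked,
      PredictedLE z h tie (nextArrival z (t + 1) x) (nextArrival z (t + 1) e)) :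
    Invariant k z h tie (t + 1) (s.replace (z t) e) := by
  obtain ⟨heC, heM⟩ := mem_sdiff.1 he
  have hne : e ≠ z t := ne_of_mem_of_not_mem heC hz
  have hmarked : #(s.replace (z t) e).marked = #s.marked + 1 :=
    card_insert_of_notMem fun hm => hz (hs.marked_subset hm)
  have hcard : #((insert (z t) s.cache).erase e) = k := by
    rw [card_erase_of_mem (mem_insert_of_mem heC), card_insert_of_notMem hz, hc,
      Nat.add_sub_cancel]
  have hmiss : s.misses + 1 = s.evictions + 1 + #((insert (z t) s.cache).erase e) := by
    rw [hs.misses_eq, hcard, hc, add_right_comm]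
  have hrep := representatives_replace (x := z t) (hs.unmarked_subset_stale he)
  have hlen_eq : ∀ y ∈ s.representatives, (s.replace (z t) e).chainLen y = s.chainLen y :=
    fun y hy => chainLen_replace_of_ne (ne_of_mem_of_not_mem heC (mem_sdiff.1 hy).2).symm
  refine ⟨hcard.le, ?_, ?_, Or.inl hcard, fun x hx => hs.requested_insert x ?_, ?_, ?_, ?_, hmiss⟩
  · exact subset_erase.2 ⟨insert_subset_insert _ hs.marked_subset,
      by simp [State.replace, hne, heM]⟩
  · rw [State.replace, insert_union]
    exact (erase_subset _ _).trans (insert_subset_insert _ hs.cache_subset)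
  · rw [← insert_union]
    exact union_subset_union_left (erase_subset _ _) hx
  all_goals simp only [hrep, forall_mem_insert, mem_erase, chainLen_replace_self]
  · refine ⟨one_le_newLen, fun y hy => ?_⟩
    rw [hlen_eq y hy.2]
    exact hs.one_le_chainLen y hy.2
  · rw [hmarked]
    refine ⟨hs.newLen_le hz, fun y hy => ?_⟩
    rw [hlen_eq y hy.2]
    exact (hs.chainLen_le y hy.2).trans (Nat.le_succ _)
  · simp only [unmarked_replace hz]
    refine ⟨fun hlen x hx => hpred hlen x (mem_of_mem_erase hx), fun y hy hlen x hx => ?_⟩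
    rw [hlen_eq y hy.2] at hlen
    have hxU := mem_of_mem_erase hx
    rw [nextArrival_succ hy.1, nextArrival_succ (ne_of_mem_of_not_mem (mem_sdiff.1 hxU).1 hz)]
    exact hs.predictedLE y hy.2 hlen x hxU

end Invariant

end Invariant

section Invariant

variable {α : Type*} {k n : ℕ} {z : Fin n → α} {h : Fin n → ℝ} {tie : Fin n → ℕ} {t : Fin n}
  {s s' : State α} {e : α}

theorem Invariant.predictedLE_of_mem_support_evictee (hs : Invariant k z h tie t s)
    (hp : PredictionsCurrent z h tie (t + 1) s.pred) (hU : s.unmarked.Nonempty)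
    (he : e ∈ (s.evictee k (z t)).support) (hlen : s.newLen (z t) ≤ detLen k) {x : α}
    (hx : x ∈ s.unmarked) :
    PredictedLE z h tie (nextArrival z (t + 1) x) (nextArrival z (t + 1) e) := by
  intro hxn hen
  have hreq : ∀ y ∈ s.unmarked, RequestedBefore z (t + 1) y := fun y hy =>
    (hs.requested y (mem_union_left _ (mem_sdiff.1 hy).1)).succ
  rw [← hp x (hreq x hx) hxn,
    ← hp e (hreq e (mem_unmarked_of_mem_support_evictee hU he)) hen]
  exact pred_le_of_mem_support_evictee he hlen hx

theorem Invariant.predictedLE_requested (hs : Invariant k z h tie t s)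
    (hz : z t ∈ s.representatives) (hlen : s.chainLen (z t) ≤ detLen k) (he : e ∈ s.unmarked) :
    PredictedLE z h tie (nextArrival z (t + 1) e) t := by
  have hez : e ≠ z t := ne_of_mem_of_not_mem (mem_sdiff.1 he).1 (mem_sdiff.1 hz).2
  have hpred := hs.predictedLE (z t) hz hlen e he
  rwa [nextArrival_self, ← nextArrival_succ hez] at hpred

theorem Invariant.card_unmarked (hs : Invariant k z h tie t s) (hc : #s.cache = k) :
    #s.unmarked = k - #s.marked := by
  rw [State.unmarked, card_sdiff_of_subset hs.marked_subset, hc]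

theorem Invariant.unmarked_nonempty (hs : Invariant k z h tie t s) (hc : #s.cache = k)
    (hm : #s.marked < k) : s.unmarked.Nonempty := by
  rw [← card_pos, hs.card_unmarked hc]
  omega

theorem Invariant.of_mem_support_step (hk : 0 < k) (hs : Invariant k z h tie t s)
    (hp : PredictionsCurrent z h tie t s.pred)
    (hs' : s' ∈ (step k (z t) (key h tie t) s).support) :
    Invariant k z h tie (t + 1) s' ∧ PredictionsCurrent z h tie (t + 1) s'.pred := by
  have hlearn := hs.learn (z t) (key h tie t)
  have hp' := hp.update
  by_cases hz : z t ∈ s.cache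
  · rw [step_of_mem hz, PMF.mem_support_pure_iff] at hs'
    exact hs' ▸ ⟨hlearn.mark hz, hp'⟩
  rcases hs.card_cache_le.lt_or_eq with hc | hc
  · rw [step_of_card_lt hz hc, PMF.mem_support_pure_iff] at hs'
    exact hs' ▸ ⟨hlearn.fetch hz hc, hp'⟩
  rw [step_of_le_card hz hc.ge, PMF.mem_support_map_iff] at hs'
  obtain ⟨e, he, rfl⟩ := hs'
  set s₁ := (s.learn (z t) (key h tie t)).newPhase k
  have hphase : Invariant k z h tie t s₁ := hlearn.newPhase hc
  have hz₁ : z t ∉ s₁.cache := by rwa [newPhase_cache]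
  have hc₁ : #s₁.cache = k := by rwa [newPhase_cache]
  have hp₁ : PredictionsCurrent z h tie (t + 1) s₁.pred := by rwa [newPhase_pred]
  have hU := hphase.unmarked_nonempty hc₁ (hlearn.card_marked_newPhase_lt hk)
  exact ⟨hphase.replace hz₁ hc₁ (mem_unmarked_of_mem_support_evictee hU he) fun hlen _ hx =>
    hphase.predictedLE_of_mem_support_evictee hp₁ hU he hlen hx, hp₁⟩

end Invariant

/-! ### Potentials -/

section Potential

variable {α : Type*} {k n : ℕ} {z : Fin n → α} {h : Fin n → ℝ} {tie : Fin n → ℕ}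

/-- A system of potentials for the analysis of Predictive Marker: every clean request pays `price`,
the eviction of an element that next arrives at time `τ` pays `weight τ` out of the budget, and
`chain c τ r` is the potential of a chain of length `c` whose representative next arrives at time
`τ`, before exactly `r` of the unmarked elements of the cache. The three last laws say that these
payments cover the evictions caused by clean elements and by the representatives of chains that
are extended by prediction and at random. -/
structure Potential (k : ℕ) (z : Fin n → α) (h : Fin n → ℝ) (tie : Fin n → ℕ) where
  price : ℝ
  budget : ℕ → Finset α → ℝ
  weight : ℕ → ℝ
  chain : ℕ → ℕ → ℕ → ℝ
  price_nonneg : 0 ≤ price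
  chain_nonneg (c τ r : ℕ) : 0 ≤ chain c τ r
  chain_mono (c τ : ℕ) : Monotone (chain c τ)
  budget_nonneg (t : ℕ) (C : Finset α) : 0 ≤ budget t C
  budget_insert (t : Fin n) (C : Finset α) : budget (t + 1) (insert (z t) C) ≤ budget t C
  budget_evict (t : Fin n) {C : Finset α} {e : α} (hz : z t ∉ C) (hC : #C = k) (he : e ∈ C) :
    budget (t + 1) ((insert (z t) C).erase e) + weight (nextArrival z (t + 1) e) ≤ budget t C
  clean (τ : ℕ) {r : ℕ} (hr : r < k) : 1 + chain 1 τ r ≤ price + weight τ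
  extend_predicted {c τ₀ τ r u : ℕ} (one_le : 1 ≤ c) (le_detLen : c + 1 ≤ detLen k) (hlt : τ₀ < τ)
    (hle : τ ≤ n) (hpred : PredictedLE z h tie τ τ₀) (hr : r < u) :
    1 + chain (c + 1) τ r ≤ chain c τ₀ u + weight τ
  extend_random (t : Fin n) {U : Finset α} {c : ℕ} (hU : U.Nonempty) (one_le : 1 ≤ c)
    (detLen_le : detLen k ≤ c) (card_le : c + #U ≤ k)
    (hpred : c = detLen k → ∀ e ∈ U, PredictedLE z h tie (nextArrival z (t + 1) e) t) :
    ∑ e ∈ U, (1 + chain (c + 1) (nextArrival z (t + 1) e) (rank z (t + 1) U e)) ≤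
      #U * chain c t #U + ∑ e ∈ U, weight (nextArrival z (t + 1) e)

namespace Potential

variable (P : Potential k z h tie)

/-- The bound on the expected final number of evictions when `s` is the state at time `t`. -/
def bound (t : ℕ) (s : State α) : ℝ :=
  s.evictions + P.price * cleanFrom k z t s.marked s.stale + P.budget t s.cache +
    ∑ e ∈ s.representatives, P.chain (s.chainLen e) (nextArrival z t e) (rank z t s.unmarked e)

/-- The part of `bound t s` that is not affected by a miss at time `t`. -/
def rest (t : Fin n) (s : State α) : ℝ :=
  s.evictions + P.price * cleanFrom k z (t + 1) (insert (z t) s.marked) s.stale +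
    P.budget t s.cache + ∑ e ∈ s.representatives.erase (z t),
      P.chain (s.chainLen e) (nextArrival z t e) (rank z t s.unmarked e)

/-- The part of `bound t s` that is released by a miss at time `t`: the price of a clean request or
the potential of the chain to be extended. -/
def credit (t : Fin n) (s : State α) : ℝ :=
  if z t ∈ s.stale then P.chain (s.chainLen (z t)) t #s.unmarked else P.price

/-- The part of `bound (t + 1)` that is added by the eviction of `e` at time `t`. -/
def cost (t : Fin n) (s : State α) (e : α) : ℝ :=
  1 + P.chain (s.newLen (z t)) (nextArrival z (t + 1) e) (rank z (t + 1) s.unmarked e) -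
    P.weight (nextArrival z (t + 1) e)

theorem sum_chain_nonneg (t : ℕ) (s : State α) :
    0 ≤ ∑ e ∈ s.representatives,
      P.chain (s.chainLen e) (nextArrival z t e) (rank z t s.unmarked e) :=
  sum_nonneg fun _ _ => P.chain_nonneg _ _ _

theorem evictions_le_bound (t : ℕ) (s : State α) : s.evictions ≤ P.bound t s := by
  have hclean : 0 ≤ P.price * cleanFrom k z t s.marked s.stale :=
    mul_nonneg P.price_nonneg (Nat.cast_nonneg _)
  have hbudget := P.budget_nonneg t s.cache
  have hchain := P.sum_chain_nonneg t s
  unfold bound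
  linarith

theorem bound_nonneg (t : ℕ) (s : State α) : 0 ≤ P.bound t s :=
  (Nat.cast_nonneg _).trans (P.evictions_le_bound t s)

variable {t : Fin n} {s : State α} {e : α}

theorem chain_rank_succ_le {U V : Finset α} (hU : z t ∉ U) (hUV : U ⊆ V) (he : e ≠ z t) (c : ℕ) :
    P.chain c (nextArrival z (t + 1) e) (rank z (t + 1) U e) ≤
      P.chain c (nextArrival z t e) (rank z t V e) := by
  rw [nextArrival_succ he, rank_succ hU he]
  exact P.chain_mono c _ (rank_mono hUV e)

theorem bound_mark_le (hs : Invariant k z h tie t s) (hz : z t ∈ s.cache) :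
    P.bound (t + 1) (s.mark (z t)) ≤ P.bound t s := by
  have hclean : cleanFrom k z (t + 1) (insert (z t) s.marked) s.stale =
      cleanFrom k z t s.marked s.stale := by
    rw [cleanFrom_eq t]
    by_cases hm : z t ∈ s.marked
    · rw [if_pos hm, insert_eq_of_mem hm]
    · have hlt : #s.marked < #s.cache :=
        card_lt_card (ssubset_iff_of_subset hs.marked_subset |>.2 ⟨z t, hz, hm⟩)
      have hzS : z t ∈ s.stale := hs.unmarked_subset_stale (mem_sdiff.2 ⟨hz, hm⟩)
      rw [if_neg hm, if_neg (hlt.trans_le hs.card_cache_le).ne, if_neg (by simp [hzS]), zero_add]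
  have hbudget := P.budget_insert t s.cache
  rw [insert_eq_of_mem hz] at hbudget
  have hchain : ∑ e ∈ s.representatives, P.chain (s.chainLen e) (nextArrival z (t + 1) e)
      (rank z (t + 1) (s.unmarked.erase (z t)) e) ≤
      ∑ e ∈ s.representatives,
        P.chain (s.chainLen e) (nextArrival z t e) (rank z t s.unmarked e) :=
    sum_le_sum fun e he => P.chain_rank_succ_le (notMem_erase _ _) (erase_subset _ _)
      (ne_of_mem_of_not_mem hz (mem_sdiff.1 he).2).symm _
  rw [bound, bound, unmarked_mark, ← hclean]
  exact add_le_add (add_le_add_right hbudget _) hchain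

theorem bound_fetch_le (hs : Invariant k z h tie t s) (hz : z t ∉ s.cache) (hc : #s.cache < k) :
    P.bound (t + 1) (s.fetch (z t)) ≤ P.bound t s := by
  have hS : s.stale = ∅ := hs.full.resolve_left hc.ne
  have hM : s.marked = s.cache := hs.marked_eq_cache hS
  have hclean : cleanFrom k z (t + 1) (insert (z t) s.marked) s.stale =
      cleanFrom k z t s.marked s.stale := by
    rw [cleanFrom_eq t, hM, if_neg hz, if_neg hc.ne, if_neg (by simp [hS]), zero_add]
  have hbudget := P.budget_insert t s.cache
  simp only [bound, State.fetch, State.representatives, ← hclean]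
  simp only [hS, empty_sdiff, sum_empty]
  gcongr

theorem bound_newPhase_le (hk : 0 < k) (hs : Invariant k z h tie t s) (hz : z t ∉ s.cache)
    (hc : #s.cache = k) : P.bound t (s.newPhase k) ≤ P.bound t s := by
  by_cases hm : #s.marked = k
  · have hM : s.marked = s.cache := eq_of_subset_of_card_le hs.marked_subset (by omega)
    have hclean : cleanFrom k z t ∅ s.cache = cleanFrom k z t s.marked s.stale := by
      have hne : s.cache.Nonempty := card_pos.1 (by omega)
      rw [cleanFrom_eq t, cleanFrom_eq (M := s.marked) t, hM, if_neg hz, if_pos hc,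
        if_neg (notMem_empty _), if_neg (by simp; omega), if_pos ⟨hne, hz⟩]
      rfl
    have hchain := P.sum_chain_nonneg t s
    rw [newPhase_of_card_eq hm]
    simp only [bound, State.representatives, hclean, Finset.sdiff_self, sum_empty] at hchain ⊢
    linarith
  · rw [newPhase_of_card_ne hm]

theorem bound_eq_rest_add_credit (hs : Invariant k z h tie t s) (hz : z t ∉ s.cache)
    (hc : #s.cache = k) (hm : #s.marked < k) : P.bound t s = P.rest t s + P.credit t s := by
  have hzM : z t ∉ s.marked := fun hzm => hz (hs.marked_subset hzm)
  have hS : s.stale.Nonempty := (hs.unmarked_nonempty hc hm).mono hs.unmarked_subset_stale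
  have hzU : z t ∉ s.unmarked := fun hzU => hz (mem_sdiff.1 hzU).1
  rw [bound, rest, credit, cleanFrom_eq t, if_neg hzM, if_neg hm.ne]
  by_cases hzS : z t ∈ s.stale
  · have hzr : z t ∈ s.representatives := mem_sdiff.2 ⟨hzS, hz⟩
    rw [if_pos hzS, if_neg (by simp [hzS]), zero_add, ← sum_erase_add _ _ hzr, nextArrival_self,
      rank_requested hzU]
    ring
  · have hzr : z t ∉ s.representatives := fun hzr => hzS (mem_sdiff.1 hzr).1
    rw [if_neg hzS, if_pos ⟨hS, hzS⟩, erase_eq_of_notMem hzr]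
    push_cast
    ring

theorem bound_replace_le (hs : Invariant k z h tie t s) (hz : z t ∉ s.cache) (hc : #s.cache = k)
    (he : e ∈ s.unmarked) : P.bound (t + 1) (s.replace (z t) e) ≤ P.rest t s + P.cost t s e := by
  have heC : e ∈ s.cache := (mem_sdiff.1 he).1
  have hzU : z t ∉ s.unmarked.erase e := fun hzU => hz (mem_sdiff.1 (mem_of_mem_erase hzU)).1
  have her : e ∉ s.representatives.erase (z t) := fun her =>
    (mem_sdiff.1 (mem_of_mem_erase her)).2 heC
  have hbudget := P.budget_evict t hz hc heC
  have hnew := P.chain_mono (s.newLen (z t)) (nextArrival z (t + 1) e)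
    (rank_mono (z := z) (t := t + 1) (erase_subset e s.unmarked) e)
  have hold : ∑ y ∈ s.representatives.erase (z t), P.chain ((s.replace (z t) e).chainLen y)
      (nextArrival z (t + 1) y) (rank z (t + 1) (s.unmarked.erase e) y) ≤
      ∑ y ∈ s.representatives.erase (z t),
        P.chain (s.chainLen y) (nextArrival z t y) (rank z t s.unmarked y) := by
    refine sum_le_sum fun y hy => ?_
    rw [chainLen_replace_of_ne (ne_of_mem_of_not_mem hy her)]
    exact P.chain_rank_succ_le hzU (erase_subset _ _) (mem_erase.1 hy).1 _
  rw [bound, rest, cost, representatives_replace (hs.unmarked_subset_stale he),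
    unmarked_replace hz, sum_insert her, chainLen_replace_self]
  simp only [State.replace] at hold ⊢
  push_cast
  linarith

theorem cost_le_credit_of_clean (hs : Invariant k z h tie t s) (hzS : z t ∉ s.stale)
    (he : e ∈ s.unmarked) : P.cost t s e ≤ P.credit t s := by
  have hr : rank z (t + 1) s.unmarked e < k :=
    (rank_lt he).trans_le ((card_le_card sdiff_subset).trans hs.card_cache_le)
  have hclean := P.clean (nextArrival z (t + 1) e) hr
  rw [cost, credit, if_neg hzS, newLen_of_notMem hzS]
  linarith

theorem cost_le_credit_of_newLen_le (hs : Invariant k z h tie t s) (hz : z t ∈ s.representatives)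
    (hlen : s.newLen (z t) ≤ detLen k) (he : e ∈ s.unmarked) : P.cost t s e ≤ P.credit t s := by
  have hzS : z t ∈ s.stale := (mem_sdiff.1 hz).1
  rw [newLen_of_mem hzS] at hlen
  have hextend := P.extend_predicted (hs.one_le_chainLen _ hz) hlen
    (le_nextArrival (x := e) t.2) (nextArrival_le t.2)
    (hs.predictedLE_requested hz (Nat.le_of_succ_le hlen) he) (rank_lt (z := z) (t := t + 1) he)
  rw [cost, credit, if_pos hzS, newLen_of_mem hzS]
  linarith

theorem sum_cost_le_card_mul_credit (hs : Invariant k z h tie t s) (hz : z t ∈ s.representatives)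
    (hc : #s.cache = k) (hm : #s.marked < k) (hlen : detLen k < s.newLen (z t)) :
    ∑ e ∈ s.unmarked, P.cost t s e ≤ #s.unmarked * P.credit t s := by
  have hzS : z t ∈ s.stale := (mem_sdiff.1 hz).1
  rw [newLen_of_mem hzS] at hlen
  have hcard : s.chainLen (z t) + #s.unmarked ≤ k := by
    have := hs.chainLen_le _ hz
    rw [hs.card_unmarked hc]
    omega
  have hextend := P.extend_random t (hs.unmarked_nonempty hc hm) (hs.one_le_chainLen _ hz)
    (Nat.le_of_lt_succ hlen) hcard fun heq _ he => hs.predictedLE_requested hz heq.le he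
  simp only [cost, credit, if_pos hzS, newLen_of_mem hzS, sum_sub_distrib]
  linarith

theorem mean_replace_le (hs : Invariant k z h tie t s) (hz : z t ∉ s.cache) (hc : #s.cache = k)
    (hm : #s.marked < k) :
    mean ((s.evictee k (z t)).map (s.replace (z t)))
      (fun s' => ENNReal.ofReal (P.bound (t + 1) s')) ≤ ENNReal.ofReal (P.bound t s) := by
  have hU := hs.unmarked_nonempty hc hm
  have hreplace := fun e he => P.bound_replace_le (e := e) hs hz hc he
  rw [mean_map, P.bound_eq_rest_add_credit hs hz hc hm, Function.comp_def]
  rcases evictee_cases (k := k) (x := z t) hU with ⟨hdet, heq⟩ | ⟨⟨hzS, hlen⟩, heq⟩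
  · have he := argmaxPred_mem s.pred hU
    have hcost : P.cost t s (argmaxPred s.pred s.unmarked hU) ≤ P.credit t s := by
      by_cases hzS : z t ∈ s.stale
      · exact P.cost_le_credit_of_newLen_le hs (mem_sdiff.2 ⟨hzS, hz⟩)
          (hdet.resolve_left (not_not.2 hzS)) he
      · exact P.cost_le_credit_of_clean hs hzS he
    rw [heq, mean_pure]
    exact ENNReal.ofReal_le_ofReal ((hreplace _ he).trans (by gcongr))
  · have hcost := P.sum_cost_le_card_mul_credit hs (mem_sdiff.2 ⟨hzS, hz⟩) hc hm hlen
    rw [heq]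
    refine mean_uniformOfFinset_ofReal_le hU (fun e _ => P.bound_nonneg _ _) ?_
    refine (sum_le_sum hreplace).trans ?_
    rw [sum_add_distrib, sum_const, nsmul_eq_mul, mul_add]
    gcongr

theorem mean_step_le (hk : 0 < k) (hs : Invariant k z h tie t s) :
    mean (step k (z t) (key h tie t) s) (fun s' => ENNReal.ofReal (P.bound (t + 1) s')) ≤
      ENNReal.ofReal (P.bound t s) := by
  have hlearn := hs.learn (z t) (key h tie t)
  by_cases hz : z t ∈ s.cache
  · rw [step_of_mem hz, mean_pure]
    exact ENNReal.ofReal_le_ofReal (P.bound_mark_le hlearn hz)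
  rcases hs.card_cache_le.lt_or_eq with hc | hc
  · rw [step_of_card_lt hz hc, mean_pure]
    exact ENNReal.ofReal_le_ofReal (P.bound_fetch_le hlearn hz hc)
  rw [step_of_le_card hz hc.ge]
  exact (P.mean_replace_le (hlearn.newPhase hc) (by rwa [newPhase_cache])
    (by rwa [newPhase_cache]) (hlearn.card_marked_newPhase_lt hk)).trans
    (ENNReal.ofReal_le_ofReal (P.bound_newPhase_le hk hlearn hz hc))

theorem expect_evictions_le (hk : 0 < k) :
    expect (predictiveMarker k z h tie) State.evictions ≤
      ENNReal.ofReal (P.price * cleanFrom k z 0 ∅ ∅ + P.budget 0 ∅) := by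
  calc expect (predictiveMarker k z h tie) State.evictions
      ≤ mean (predictiveMarker k z h tie) fun s => ENNReal.ofReal (P.bound n s) := by
        refine mean_mono fun s _ => ?_
        rw [← ENNReal.ofReal_natCast]
        exact ENNReal.ofReal_le_ofReal (P.evictions_le_bound n s)
    _ ≤ ENNReal.ofReal (P.bound 0 (State.init α)) :=
        mean_foldl_bind_le (Φ := fun t s => ENNReal.ofReal (P.bound t s))
          (I := fun t s => Invariant k z h tie t s ∧ PredictionsCurrent z h tie t s.pred)
          ⟨Invariant.init k z h tie, predictionsCurrent_zero _⟩
          (fun t s hs s' => Invariant.of_mem_support_step hk hs.1 hs.2)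
          fun t s hs => P.mean_step_le hk hs.1
    _ = _ := by simp [bound, State.init, State.representatives]

end Potential

end Potential

section Misses

variable {α : Type*} {k n : ℕ}

theorem expect_misses_le_expect_evictions_add (hk : 0 < k) (z : Fin n → α) (h : Fin n → ℝ)
    (tie : Fin n → ℕ) :
    expect (predictiveMarker k z h tie) State.misses ≤
      expect (predictiveMarker k z h tie) State.evictions + (min k #(univ.image z) : ℕ) := by
  have hinv : ∀ s ∈ (predictiveMarker k z h tie).support,
      Invariant k z h tie n s ∧ PredictionsCurrent z h tie n s.pred :=
    forall_mem_support_foldl_bind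
      (I := fun t s => Invariant k z h tie t s ∧ PredictionsCurrent z h tie t s.pred)
      ⟨Invariant.init k z h tie, predictionsCurrent_zero _⟩
      (fun t s hs s' => Invariant.of_mem_support_step hk hs.1 hs.2)
  refine (mean_mono fun s hs => ?_).trans (mean_add_const _ _ _).le
  have hs := (hinv s hs).1
  have hcache : s.cache ⊆ univ.image z := fun x hx => by
    obtain ⟨i, -, rfl⟩ := hs.requested x (mem_union_left _ hx)
    exact mem_image_of_mem z (mem_univ i)
  have hcard := le_min hs.card_cache_le (card_le_card hcache)
  exact_mod_cast hs.misses_eq.trans_le (Nat.add_le_add_left hcard s.evictions)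

end Misses

/-! ### Harmonic numbers -/

section Harmonic

variable {k u : ℕ}

theorem harmonic_mono {i j : ℕ} (hij : i ≤ j) : (harmonic i : ℝ) ≤ harmonic j := by
  refine monotone_nat_of_le_succ (f := fun i => (harmonic i : ℝ)) (fun i => ?_) hij
  rw [harmonic_succ, Rat.cast_add]
  exact le_add_of_nonneg_right (by positivity)

theorem harmonic_nonneg (i : ℕ) : (0 : ℝ) ≤ harmonic i := by
  simpa using harmonic_mono (Nat.zero_le i)

theorem one_le_harmonic (hk : 0 < k) : (1 : ℝ) ≤ harmonic k := by
  simpa using harmonic_mono (Nat.succ_le_of_lt hk)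

theorem sum_range_harmonic (u : ℕ) : ∑ j ∈ range u, (harmonic j : ℝ) = u * harmonic u - u := by
  induction u with
  | zero => simp
  | succ u ih =>
    rw [sum_range_succ, ih, harmonic_succ]
    push_cast
    field_simp
    ring

theorem sum_range_max_harmonic_sub_one (u : ℕ) :
    ∑ j ∈ range (u + 1), max ((harmonic j : ℝ) - 1) 0 =
      (u + 1) * harmonic (u + 1) - 2 * (u + 1) + 1 := by
  have hmax : ∀ j ∈ range u, max ((harmonic (j + 1) : ℝ) - 1) 0 = harmonic (j + 1) - 1 :=
    fun j _ => max_eq_left (sub_nonneg.2 (one_le_harmonic j.succ_pos))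
  have hsum := sum_range_harmonic (u + 1)
  rw [sum_range_succ', harmonic_zero, Rat.cast_zero, add_zero] at hsum
  rw [sum_range_succ', sum_congr rfl hmax, sum_sub_distrib, hsum, harmonic_zero]
  push_cast [sum_const, card_range, nsmul_eq_mul]
  rw [max_eq_right (by norm_num)]
  ring

theorem detLen_le_harmonic (k : ℕ) : (detLen k : ℝ) ≤ harmonic k := by
  exact_mod_cast natCast_le_harmonic_iff.2 (le_refl (detLen k))

theorem harmonic_lt_detLen_add_one (k : ℕ) : (harmonic k : ℝ) < detLen k + 1 := by
  exact_mod_cast Nat.lt_floor_add_one (harmonic k)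

theorem one_le_detLen (hk : 0 < k) : 1 ≤ detLen k := by
  rw [← natCast_le_harmonic_iff]
  exact_mod_cast one_le_harmonic hk

theorem two_le_detLen (hk : 4 ≤ k) : 2 ≤ detLen k := by
  have hfour : (2 : ℝ) ≤ harmonic 4 := by norm_num [harmonic, sum_range_succ]
  rw [← natCast_le_harmonic_iff]
  exact_mod_cast hfour.trans (harmonic_mono hk)

theorem harmonic_add_inv_le_harmonic_add_two (hu : 2 ≤ u) :
    (harmonic u : ℝ) + (u : ℝ)⁻¹ ≤ harmonic (u + 2) := by
  have hu' : (2 : ℝ) ≤ u := by exact_mod_cast hu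
  have hinv : (u : ℝ)⁻¹ ≤ ((u : ℝ) + 1)⁻¹ + ((u : ℝ) + 1 + 1)⁻¹ := by
    rw [inv_add_inv (by positivity) (by positivity), inv_eq_one_div,
      div_le_div_iff₀ (by positivity) (by positivity)]
    nlinarith
  rw [harmonic_succ, harmonic_succ]
  push_cast
  linarith

theorem harmonic_add_inv_le_detLen_add_one (hu : 0 < u) (huk : detLen k + u ≤ k) :
    (harmonic u : ℝ) + (u : ℝ)⁻¹ ≤ detLen k + 1 := by
  have hone : (1 : ℝ) ≤ detLen k := by exact_mod_cast one_le_detLen (k := k) (by omega)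
  rcases (by omega : u = 1 ∨ u = 2 ∨ 3 ≤ u) with rfl | rfl | hu
  · norm_num
    linarith
  · norm_num [harmonic, sum_range_succ]
    linarith
  · have hk : 4 ≤ k := by
      have := one_le_detLen (k := k) (by omega)
      omega
    have huk' : u + 2 ≤ k := by
      have := two_le_detLen hk
      omega
    calc (harmonic u : ℝ) + (u : ℝ)⁻¹
        ≤ harmonic (u + 2) := harmonic_add_inv_le_harmonic_add_two (by omega)
      _ ≤ harmonic k := harmonic_mono huk'
      _ ≤ detLen k + 1 := (harmonic_lt_detLen_add_one k).le

theorem sum_range_max_harmonic_sub_one_le (hu : 0 < u) (huk : detLen k + u ≤ k) :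
    ∑ j ∈ range u, max ((harmonic j : ℝ) - 1) 0 ≤ u * (detLen k - 1) := by
  obtain ⟨u, rfl⟩ := Nat.exists_eq_succ_of_ne_zero hu.ne'
  have hinv := harmonic_add_inv_le_detLen_add_one hu huk
  rw [Nat.succ_eq_add_one] at hinv ⊢
  calc ∑ j ∈ range (u + 1), max ((harmonic j : ℝ) - 1) 0
      = (u + 1 : ℕ) * (harmonic (u + 1) + ((u + 1 : ℕ) : ℝ)⁻¹ - 2) := by
        rw [sum_range_max_harmonic_sub_one]
        push_cast
        field_simp
        ring
    _ ≤ (u + 1 : ℕ) * (detLen k - 1) := by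
        gcongr ?_ * ?_
        linarith

end Harmonic

/-! ### The bound without predictions -/

section Robust

variable {α : Type*} {k n : ℕ}

/-- The potential of a chain in the analysis that ignores the predictions: its remaining evictions
by prediction and the expected number `H_r` of its random evictions. -/
def robustChain (k n c τ r : ℕ) : ℝ :=
  if τ < n then ((detLen k - c : ℕ) : ℝ) + harmonic r else 0

theorem robustChain_nonneg (k n c τ r : ℕ) : 0 ≤ robustChain k n c τ r := by
  have := harmonic_nonneg r
  unfold robustChain
  split_ifs <;> positivity

theorem robustChain_le (k n c τ r : ℕ) :
    robustChain k n c τ r ≤ ((detLen k - c : ℕ) : ℝ) + harmonic r := by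
  have := harmonic_nonneg r
  unfold robustChain
  split_ifs
  · rfl
  · positivity

/-- The potentials that show that Predictive Marker pays `2 * H_k` for every clean request. -/
def robustPotential (hk : 0 < k) (z : Fin n → α) (h : Fin n → ℝ) (tie : Fin n → ℕ) :
    Potential k z h tie where
  price := 2 * harmonic k
  budget _ _ := 0
  weight _ := 0
  chain := robustChain k n
  price_nonneg := mul_nonneg two_pos.le (harmonic_nonneg k)
  chain_nonneg := robustChain_nonneg k n
  chain_mono c τ r r' hr := by
    have := harmonic_mono hr
    unfold robustChain
    split_ifs <;> linarith
  budget_nonneg _ _ := le_rfl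
  budget_insert _ _ := le_rfl
  budget_evict _ _ _ _ _ _ := (add_zero _).le
  clean τ r hr := by
    have hchain := robustChain_le k n 1 τ r
    have hH := harmonic_mono hr.le
    have hdet := detLen_le_harmonic k
    rw [Nat.cast_sub (one_le_detLen hk)] at hchain
    push_cast at hchain
    linarith
  extend_predicted {c τ₀ τ r u} _ hc hτ hτn _ hr := by
    have hchain := robustChain_le k n (c + 1) τ r
    have hH := harmonic_mono hr.le
    have hdet : ((detLen k - c : ℕ) : ℝ) = ((detLen k - (c + 1) : ℕ) : ℝ) + 1 := by
      exact_mod_cast (by omega : detLen k - c = detLen k - (c + 1) + 1)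
    rw [robustChain.eq_def (τ := τ₀), if_pos (hτ.trans_le hτn), hdet]
    linarith
  extend_random t U c _ _ hc _ _ := by
    have hrank := sum_rank_le (z := z) (U := U) t.2 harmonic_nonneg
    rw [sum_range_harmonic] at hrank
    simp only [robustChain, t.2, if_true, Nat.sub_eq_zero_of_le hc,
      Nat.sub_eq_zero_of_le (hc.trans c.le_succ), sum_add_distrib, ← sum_filter, sum_const_zero,
      sum_const, nsmul_eq_mul, Nat.cast_zero, zero_add, add_zero, mul_one] at hrank ⊢
    linarith

end Robust

/-! ### The bound by the error of the predictions -/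

section Error

variable {α : Type*} {k n : ℕ} {z : Fin n → α} {h : Fin n → ℝ} {tie : Fin n → ℕ}
  {K : Finset (Fin n)}

/-- The elements requested at time `t` or later. -/
def requestedFrom (z : Fin n → α) (t : ℕ) : Finset α :=
  ({i : Fin n | t ≤ i} : Finset (Fin n)).image z

/-- The arrivals outside of `K` from time `t` on that are not the next arrival of an element that
was evicted before time `t`, where `C` is the cache at that time. -/
def openArrivals (z : Fin n → α) (K : Finset (Fin n)) (t : ℕ) (C : Finset α) : Finset (Fin n) :=
  {τ | τ ∉ K ∧ t ≤ τ ∧ ((∃ i : Fin n, t ≤ i ∧ i < τ ∧ z i = z τ) ∨ z τ ∈ C)}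

/-- The budget for the evictions of elements that never arrive again, and of elements whose next
arrival is not in `K`. -/
def errorBudget (k : ℕ) (z : Fin n → α) (K : Finset (Fin n)) (t : ℕ) (C : Finset α) : ℝ :=
  ((#(C ∪ requestedFrom z t) - k : ℕ) : ℝ) + 2 * #(openArrivals z K t C)

/-- What the eviction of an element that next arrives at time `τ` takes out of the budget. -/
def errorWeight (K : Finset (Fin n)) (τ : ℕ) : ℝ :=
  if hτ : τ < n then if ⟨τ, hτ⟩ ∈ K then 0 else 2 else 1

/-- Some arrival in `K` up to time `τ` is predicted to come no earlier than the one at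
time `τ`. -/
def Dominated (z : Fin n → α) (h : Fin n → ℝ) (tie : Fin n → ℕ) (K : Finset (Fin n)) (τ : ℕ) :
    Prop :=
  ∃ a ∈ K, a ≤ τ ∧ PredictedLE z h tie τ a

/-- The amount that a chain whose representative next arrives at time `τ` has in store for its one
future representative that may arrive at a time in `K`. -/
def errorReserve (z : Fin n → α) (h : Fin n → ℝ) (tie : Fin n → ℕ) (K : Finset (Fin n)) (τ : ℕ) :
    ℝ :=
  if Dominated z h tie K τ then 0 else 2

/-- The potential of a chain in the analysis by the error of the predictions. -/
def errorChain (k : ℕ) (z : Fin n → α) (h : Fin n → ℝ) (tie : Fin n → ℕ) (K : Finset (Fin n))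
    (c τ r : ℕ) : ℝ :=
  if τ < n then
    if c ≤ detLen k then ((c - 1 : ℕ) : ℝ) + errorReserve z h tie K τ else harmonic r
  else 0

section Budget

theorem mem_requestedFrom {t : ℕ} {x : α} :
    x ∈ requestedFrom z t ↔ ∃ i : Fin n, t ≤ i ∧ z i = x := by
  simp [requestedFrom]

theorem mem_openArrivals {t : ℕ} {C : Finset α} {τ : Fin n} :
    τ ∈ openArrivals z K t C ↔
      τ ∉ K ∧ t ≤ τ ∧ ((∃ i : Fin n, t ≤ i ∧ i < τ ∧ z i = z τ) ∨ z τ ∈ C) := by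
  simp [openArrivals]

variable {t : Fin n} {C C' : Finset α} {e : α}

theorem union_requestedFrom_subset (hC : C' ⊆ insert (z t) C) :
    C' ∪ requestedFrom z (t + 1) ⊆ C ∪ requestedFrom z t := by
  intro x hx
  rw [mem_union, mem_requestedFrom] at hx ⊢
  rcases hx with hx | ⟨i, hi, rfl⟩
  · rcases mem_insert.1 (hC hx) with rfl | hx
    · exact Or.inr ⟨t, le_rfl, rfl⟩
    · exact Or.inl hx
  · exact Or.inr ⟨i, Nat.le_of_succ_le hi, rfl⟩

theorem openArrivals_subset (hC : C' ⊆ insert (z t) C) :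
    openArrivals z K (t + 1) C' ⊆ openArrivals z K t C := by
  intro τ hτ
  rw [mem_openArrivals] at hτ ⊢
  obtain ⟨hτK, htτ, ⟨i, hti, hi⟩ | hzτ⟩ := hτ
  · exact ⟨hτK, Nat.le_of_succ_le htτ, Or.inl ⟨i, Nat.le_of_succ_le hti, hi⟩⟩
  · refine ⟨hτK, Nat.le_of_succ_le htτ, ?_⟩
    rcases mem_insert.1 (hC hzτ) with hzτ | hzτ
    · exact Or.inl ⟨t, le_rfl, Fin.lt_def.2 htτ, hzτ.symm⟩
    · exact Or.inr hzτ

theorem errorBudget_le (hC : C' ⊆ insert (z t) C) :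
    errorBudget k z K (t + 1) C' ≤ errorBudget k z K t C := by
  have hrequested := card_le_card (union_requestedFrom_subset hC)
  have hopen := card_le_card (openArrivals_subset (K := K) hC)
  unfold errorBudget
  gcongr

theorem card_union_requestedFrom_lt (hez : e ∈ C) (hne : n ≤ nextArrival z (t + 1) e) :
    #((insert (z t) C).erase e ∪ requestedFrom z (t + 1)) < #(C ∪ requestedFrom z t) := by
  refine card_lt_card (ssubset_iff_of_subset (union_requestedFrom_subset (erase_subset _ _)) |>.2
    ⟨e, mem_union_left _ hez, fun he => ?_⟩)
  rcases mem_union.1 he with he | he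
  · exact notMem_erase _ _ he
  · obtain ⟨i, hi, hzi⟩ := mem_requestedFrom.1 he
    exact (hne.trans (nextArrival_le_of_eq hi hzi)).not_gt i.2

theorem card_openArrivals_lt (he : e ∈ C) (hen : nextArrival z (t + 1) e < n)
    (hK : ⟨nextArrival z (t + 1) e, hen⟩ ∉ K) :
    #(openArrivals z K (t + 1) ((insert (z t) C).erase e)) < #(openArrivals z K t C) := by
  have hz := apply_nextArrival t.2 hen
  have hle : t.1 ≤ nextArrival z (t + 1) e := Nat.le_of_succ_le (le_nextArrival t.2)
  refine card_lt_card (ssubset_iff_of_subset (openArrivals_subset (erase_subset _ _)) |>.2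
    ⟨⟨_, hen⟩, mem_openArrivals.2 ⟨hK, hle, Or.inr (hz.symm ▸ he)⟩, fun hτ => ?_⟩)
  obtain ⟨-, -, ⟨i, hti, hi, hzi⟩ | hτ⟩ := mem_openArrivals.1 hτ
  · exact (nextArrival_le_of_eq hti (hzi.trans hz)).not_gt hi
  · rw [hz] at hτ
    exact notMem_erase _ _ hτ

theorem errorBudget_erase_add_errorWeight_le (hz : z t ∉ C) (hC : #C = k) (he : e ∈ C) :
    errorBudget k z K (t + 1) ((insert (z t) C).erase e) + errorWeight K (nextArrival z (t + 1) e) ≤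
      errorBudget k z K t C := by
  have hmono := errorBudget_le (k := k) (K := K) (erase_subset e (insert (z t) C))
  have hk : k + 1 ≤ #(C ∪ requestedFrom z t) := by
    rw [← hC, ← card_insert_of_notMem hz]
    exact card_le_card (insert_subset
      (mem_union_right _ (mem_requestedFrom.2 ⟨t, le_rfl, rfl⟩)) subset_union_left)
  unfold errorBudget errorWeight at *
  split_ifs with hen hK
  · linarith
  · have hopen : (#(openArrivals z K (t + 1) ((insert (z t) C).erase e)) : ℝ) + 1 ≤
        #(openArrivals z K t C) := by exact_mod_cast card_openArrivals_lt he hen hK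
    have hrequested := card_le_card (union_requestedFrom_subset (erase_subset e (insert (z t) C)))
    have hsub : ((#((insert (z t) C).erase e ∪ requestedFrom z (t + 1)) - k : ℕ) : ℝ) ≤
        (#(C ∪ requestedFrom z t) - k : ℕ) := by gcongr
    linarith
  · have hlt := card_union_requestedFrom_lt he (not_lt.1 hen)
    have hsub : ((#((insert (z t) C).erase e ∪ requestedFrom z (t + 1)) - k : ℕ) : ℝ) + 1 ≤
        (#(C ∪ requestedFrom z t) - k : ℕ) := by exact_mod_cast (by omega)
    have hopen : (#(openArrivals z K (t + 1) ((insert (z t) C).erase e)) : ℝ) ≤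
        #(openArrivals z K t C) := by gcongr; exact openArrivals_subset (erase_subset _ _)
    linarith

end Budget

section Reserve

variable {τ τ₀ c r : ℕ}

theorem errorWeight_nonneg (K : Finset (Fin n)) (τ : ℕ) : 0 ≤ errorWeight K τ := by
  unfold errorWeight
  split_ifs <;> norm_num

theorem errorWeight_of_le (hτ : n ≤ τ) : errorWeight K τ = 1 := dif_neg hτ.not_gt

theorem errorReserve_nonneg (z : Fin n → α) (h : Fin n → ℝ) (tie : Fin n → ℕ) (K : Finset (Fin n))
    (τ : ℕ) : 0 ≤ errorReserve z h tie K τ := by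
  unfold errorReserve
  split_ifs <;> norm_num

theorem errorReserve_le_errorWeight (hτ : τ < n) : errorReserve z h tie K τ ≤ errorWeight K τ := by
  rw [errorReserve, errorWeight, dif_pos hτ]
  by_cases hτK : (⟨τ, hτ⟩ : Fin n) ∈ K
  · rw [if_pos hτK, if_pos ⟨_, hτK, le_rfl, fun _ _ => le_rfl⟩]
  · rw [if_neg hτK]
    split_ifs <;> norm_num

theorem two_add_errorReserve_le (hK : StrictMonoOn (arrivalKey z h tie) K) (hlt : τ₀ < τ)
    (hτ : τ < n) (hpred : PredictedLE z h tie τ τ₀) :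
    2 + errorReserve z h tie K τ ≤ errorReserve z h tie K τ₀ + errorWeight K τ := by
  by_cases hdom : Dominated z h tie K τ₀
  · obtain ⟨a, haK, haτ₀, hpred₀⟩ := hdom
    have hpred_a : PredictedLE z h tie τ a := fun hτ ha =>
      (hpred hτ (hlt.trans hτ)).trans (hpred₀ (hlt.trans hτ) ha)
    have hτK : ⟨τ, hτ⟩ ∉ K := fun hτK =>
      (hK haK hτK (Fin.lt_def.2 (haτ₀.trans_lt hlt))).not_ge (hpred_a hτ a.2)
    rw [errorReserve, if_pos ⟨a, haK, haτ₀.trans hlt.le, hpred_a⟩, errorReserve,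
      if_pos ⟨a, haK, haτ₀, hpred₀⟩, errorWeight, dif_pos hτ, if_neg hτK]
    norm_num
  · rw [errorReserve.eq_def (τ := τ₀), if_neg hdom]
    gcongr
    exact errorReserve_le_errorWeight hτ

theorem errorChain_of_le (hτ : n ≤ τ) : errorChain k z h tie K c τ r = 0 := if_neg hτ.not_gt

theorem errorChain_of_le_detLen (hτ : τ < n) (hc : c ≤ detLen k) :
    errorChain k z h tie K c τ r = ((c - 1 : ℕ) : ℝ) + errorReserve z h tie K τ := by
  rw [errorChain, if_pos hτ, if_pos hc]

theorem errorChain_of_detLen_lt (hτ : τ < n) (hc : detLen k < c) :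
    errorChain k z h tie K c τ r = harmonic r := by
  rw [errorChain, if_pos hτ, if_neg hc.not_ge]

theorem errorChain_nonneg (c τ r : ℕ) : 0 ≤ errorChain k z h tie K c τ r := by
  have hH := harmonic_nonneg r
  have hreserve := errorReserve_nonneg z h tie K τ
  unfold errorChain
  split_ifs <;> positivity

theorem errorChain_mono (c τ : ℕ) : Monotone (errorChain k z h tie K c τ) := by
  intro r r' hr
  have hH := harmonic_mono hr
  unfold errorChain
  split_ifs <;> linarith

theorem one_add_errorChain_one_le (hk : 0 < k) :
    1 + errorChain k z h tie K 1 τ r ≤ 1 + errorWeight K τ := by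
  gcongr
  rcases lt_or_ge τ n with hτ | hτ
  · rw [errorChain_of_le_detLen hτ (one_le_detLen hk), Nat.sub_self, Nat.cast_zero, zero_add]
    exact errorReserve_le_errorWeight hτ
  · rw [errorChain_of_le hτ]
    exact errorWeight_nonneg K τ

theorem one_add_errorChain_succ_le_of_predicted {u : ℕ}
    (hK : StrictMonoOn (arrivalKey z h tie) K) (one_le : 1 ≤ c) (hc : c + 1 ≤ detLen k)
    (hlt : τ₀ < τ) (hτ : τ ≤ n) (hpred : PredictedLE z h tie τ τ₀) :
    1 + errorChain k z h tie K (c + 1) τ r ≤ errorChain k z h tie K c τ₀ u + errorWeight K τ := by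
  rw [errorChain_of_le_detLen (hlt.trans_le hτ) (Nat.le_of_succ_le hc)]
  rcases hτ.lt_or_eq with hτ | rfl
  · have hreserve := two_add_errorReserve_le hK hlt hτ hpred
    rw [errorChain_of_le_detLen hτ hc, Nat.add_sub_cancel, Nat.cast_sub one_le]
    push_cast
    linarith
  · have hreserve := errorReserve_nonneg z h tie K τ₀
    rw [errorChain_of_le le_rfl, errorWeight_of_le le_rfl, add_zero]
    exact le_add_of_nonneg_left (by positivity)

theorem one_add_errorChain_le_of_last_predicted (hK : StrictMonoOn (arrivalKey z h tie) K)
    (hc : detLen k < c) (hlt : τ₀ < τ) (hpred : PredictedLE z h tie τ τ₀) :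
    1 + errorChain k z h tie K c τ r ≤
      (if τ < n then max ((harmonic r : ℝ) - 1) 0 else 0) + errorReserve z h tie K τ₀ +
        errorWeight K τ := by
  rcases lt_or_ge τ n with hτ | hτ
  · have hreserve := two_add_errorReserve_le hK hlt hτ hpred
    have hnonneg := errorReserve_nonneg z h tie K τ
    have hmax := le_max_left ((harmonic r : ℝ) - 1) 0
    rw [errorChain_of_detLen_lt hτ hc, if_pos hτ]
    linarith
  · have hnonneg := errorReserve_nonneg z h tie K τ₀
    rw [errorChain_of_le hτ, errorWeight_of_le hτ, if_neg hτ.not_gt]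
    linarith

end Reserve

section Random

variable {t : Fin n} {U : Finset α} {c : ℕ}

theorem sum_one_add_errorChain_le_of_last_predicted (hK : StrictMonoOn (arrivalKey z h tie) K)
    (hU : U.Nonempty) (one_le : 1 ≤ detLen k) (hcard : detLen k + #U ≤ k)
    (hpred : ∀ e ∈ U, PredictedLE z h tie (nextArrival z (t + 1) e) t) :
    ∑ e ∈ U, (1 + errorChain k z h tie K (detLen k + 1) (nextArrival z (t + 1) e)
        (rank z (t + 1) U e)) ≤
      #U * errorChain k z h tie K (detLen k) t #U +
        ∑ e ∈ U, errorWeight K (nextArrival z (t + 1) e) := by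
  have hrank : ∑ e ∈ U, (if nextArrival z (t + 1) e < n then
      max ((harmonic (rank z (t + 1) U e) : ℝ) - 1) 0 else 0) ≤ #U * (detLen k - 1) := by
    rw [← sum_filter]
    exact (sum_rank_le t.2 (g := fun j => max ((harmonic j : ℝ) - 1) 0)
      fun _ => le_max_right _ _).trans
        (sum_range_max_harmonic_sub_one_le (card_pos.2 hU) hcard)
  refine (sum_le_sum fun e he => one_add_errorChain_le_of_last_predicted hK (Nat.lt_succ_self _)
    (le_nextArrival t.2) (hpred e he)).trans ?_
  rw [sum_add_distrib, sum_add_distrib, sum_const, nsmul_eq_mul, errorChain_of_le_detLen t.2 le_rfl,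
    Nat.cast_sub one_le, Nat.cast_one, mul_add]
  linarith

theorem sum_one_add_errorChain_le_of_detLen_lt (hc : detLen k < c) :
    ∑ e ∈ U, (1 + errorChain k z h tie K (c + 1) (nextArrival z (t + 1) e)
        (rank z (t + 1) U e)) ≤
      #U * errorChain k z h tie K c t #U + ∑ e ∈ U, errorWeight K (nextArrival z (t + 1) e) := by
  have hrank := sum_rank_le (z := z) (U := U) t.2 harmonic_nonneg
  have hweight : 0 ≤ ∑ e ∈ U, errorWeight K (nextArrival z (t + 1) e) :=
    sum_nonneg fun _ _ => errorWeight_nonneg K _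
  have hchain : ∀ e, errorChain k z h tie K (c + 1) (nextArrival z (t + 1) e)
      (rank z (t + 1) U e) =
      if nextArrival z (t + 1) e < n then (harmonic (rank z (t + 1) U e) : ℝ) else 0 := fun e => by
    rw [errorChain, if_neg (Nat.lt_succ_of_lt hc).not_ge]
  rw [sum_range_harmonic] at hrank
  rw [errorChain_of_detLen_lt t.2 hc, sum_add_distrib, sum_congr rfl fun e _ => hchain e,
    ← sum_filter, sum_const, nsmul_eq_mul, mul_one]
  linarith

end Random

/-- The potentials that show that Predictive Marker pays `1` for every clean request and `2` for
every arrival outside of the set `K`, on which the predictions are in the right order. -/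
def errorPotential (hk : 0 < k) (hK : StrictMonoOn (arrivalKey z h tie) K) :
    Potential k z h tie where
  price := 1
  budget := errorBudget k z K
  weight := errorWeight K
  chain := errorChain k z h tie K
  price_nonneg := zero_le_one
  chain_nonneg := errorChain_nonneg
  chain_mono := errorChain_mono
  budget_nonneg t C := by
    unfold errorBudget
    positivity
  budget_insert _ _ := errorBudget_le subset_rfl
  budget_evict _ _ _ := errorBudget_erase_add_errorWeight_le
  clean _ _ _ := one_add_errorChain_one_le hk
  extend_predicted one_le hc hlt hτ hpred _ :=
    one_add_errorChain_succ_le_of_predicted hK one_le hc hlt hτ hpred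
  extend_random t U c hU one_le hc hcard hpred := by
    rcases hc.lt_or_eq with hc | rfl
    · exact sum_one_add_errorChain_le_of_detLen_lt hc
    · exact sum_one_add_errorChain_le_of_last_predicted hK hU one_le hcard (hpred rfl)

end Error

/-! ### Lower bounds on the offline optimum -/

section Offline

variable {α : Type*} {k n d a b : ℕ} {z : Fin n → α} {C : ℕ → Finset α} {cost : ℕ → ℕ}

/-- The elements that are in the cache of the schedule `C` at some time in `[a, b]`. -/
def cachedIn (C : ℕ → Finset α) (a b : ℕ) : Finset α := (Icc a b).biUnion C

theorem cachedIn_mono (C : ℕ → Finset α) {a' b' : ℕ} (ha : a' ≤ a) (hb : b ≤ b') :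
    cachedIn C a b ⊆ cachedIn C a' b' :=
  biUnion_subset_biUnion_of_subset_left _ (Icc_subset_Icc ha hb)

theorem cachedIn_self (C : ℕ → Finset α) (a : ℕ) : cachedIn C a a = C a := by simp [cachedIn]

theorem cachedIn_succ (C : ℕ → Finset α) (hab : a ≤ b) :
    cachedIn C a (b + 1) = C (b + 1) ∪ cachedIn C a b := by
  rw [cachedIn, cachedIn, ← biUnion_insert]
  exact congrArg (·.biUnion C) (insert_Icc_right_eq_Icc_succ (Nat.le_succ_of_le hab)).symm

theorem subset_cachedIn (C : ℕ → Finset α) (hab : a ≤ b) : C b ⊆ cachedIn C a b :=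
  subset_biUnion_of_mem C (right_mem_Icc.2 hab)

/-- The number of misses of a schedule before time `b`. -/
def missesUntil (z : Fin n → α) (C : ℕ → Finset α) (b : ℕ) : ℕ :=
  ∑ i ∈ range b, if hi : i < n then if z ⟨i, hi⟩ ∈ C i then 0 else 1 else 0

/-- The number of evictions of a schedule before time `b`. -/
def evictionsUntil (C : ℕ → Finset α) (b : ℕ) : ℕ := ∑ i ∈ range b, #(C i \ C (i + 1))

theorem missesUntil_eq_scheduleMisses : missesUntil z C n = scheduleMisses z C := by
  rw [missesUntil, scheduleMisses, card_filter, sum_range]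
  simp only [Fin.is_lt, dite_true, ite_not]

theorem evictionsUntil_eq_scheduleEvictions : evictionsUntil C n = scheduleEvictions n C :=
  sum_range _

theorem card_cachedIn_add_missesUntil_le (hC : IsSchedule k z C) (hab : a ≤ b) (hb : b ≤ n) :
    #(cachedIn C a b) + missesUntil z C a ≤ #(C a) + missesUntil z C b := by
  induction b, hab using Nat.le_induction with
  | base => rw [cachedIn_self]
  | succ b hab ih =>
    have hsub := subset_cachedIn C hab
    have hsucc : #(cachedIn C a (b + 1)) ≤
        #(cachedIn C a b) + if z ⟨b, hb⟩ ∈ C b then 0 else 1 := by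
      rw [cachedIn_succ C hab]
      split_ifs with hz
      · refine card_le_card (union_subset (fun x hx => hsub ?_) subset_rfl)
        exact (hC.subset ⟨b, hb⟩ x hx).elim (fun h => h ▸ hz) id
      · refine (card_le_card (union_subset (fun x hx => ?_) (subset_insert _ _))).trans
          (card_insert_le (z ⟨b, hb⟩) _)
        exact mem_insert.2 ((hC.subset ⟨b, hb⟩ x hx).imp_right fun h => hsub h)
    have hmisses : missesUntil z C (b + 1) =
        missesUntil z C b + if z ⟨b, hb⟩ ∈ C b then 0 else 1 := by
      rw [missesUntil, sum_range_succ, dif_pos (Nat.lt_of_succ_le hb), missesUntil]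
    have := ih (Nat.le_of_succ_le hb)
    omega

theorem card_cachedIn_sdiff_add_evictionsUntil_le (C : ℕ → Finset α) (hab : a ≤ b) :
    #(cachedIn C a b \ C b) + evictionsUntil C a ≤ evictionsUntil C b := by
  induction b, hab using Nat.le_induction with
  | base => simp [cachedIn_self]
  | succ b hab ih =>
    have hsub : cachedIn C a (b + 1) \ C (b + 1) ⊆
        (cachedIn C a b \ C b) ∪ (C b \ C (b + 1)) := by
      rw [cachedIn_succ C hab]
      intro x
      simp only [mem_sdiff, mem_union]
      tauto
    have hcard := (card_le_card hsub).trans (card_union_le _ _)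
    have hevictions : evictionsUntil C (b + 1) = evictionsUntil C b + #(C b \ C (b + 1)) :=
      sum_range_succ _ _
    omega

theorem card_cachedIn_add_evictionsUntil_le (C : ℕ → Finset α) (hab : a ≤ b) :
    #(cachedIn C a b) + evictionsUntil C a ≤ #(C b) + evictionsUntil C b := by
  have hsdiff := card_cachedIn_sdiff_add_evictionsUntil_le C hab
  have hcard := card_sdiff_add_card (cachedIn C a b) (C b)
  have hunion := card_le_card (subset_union_left (s₁ := cachedIn C a b) (s₂ := C b))
  omega

/-- The properties of the cost `cost b` of the schedule `C` before time `b` that give lower bounds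
on it. The number `d` is how many elements are cached for free from the initially empty cache:
none if misses are counted, and `k` if evictions are counted. -/
structure IsCachingCost (k n d : ℕ) (C : ℕ → Finset α) (cost : ℕ → ℕ) : Prop where
  mono : Monotone cost
  card_add_le : ∀ ⦃a b⦄, a ≤ b → b ≤ n → #(cachedIn C a b) + cost a ≤ k + cost b
  card_le : ∀ ⦃b⦄, b ≤ n → #(cachedIn C 0 b) ≤ d + cost b

theorem isCachingCost_missesUntil (hC : IsSchedule k z C) :
    IsCachingCost k n 0 C (missesUntil z C) where
  mono _ _ hab := sum_le_sum_of_subset (range_subset_range.2 hab)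
  card_add_le a _ hab hb :=
    (card_cachedIn_add_missesUntil_le hC hab hb).trans (Nat.add_le_add_right (hC.card_le a) _)
  card_le b hb := by
    have hcard := card_cachedIn_add_missesUntil_le hC (Nat.zero_le b) hb
    rw [hC.zero, card_empty] at hcard
    exact (Nat.le_add_right _ _).trans hcard

theorem isCachingCost_evictionsUntil (hC : IsSchedule k z C) :
    IsCachingCost k n k C (evictionsUntil C) where
  mono _ _ hab := sum_le_sum_of_subset (range_subset_range.2 hab)
  card_add_le _ b hab _ :=
    (card_cachedIn_add_evictionsUntil_le C hab).trans (Nat.add_le_add_right (hC.card_le b) _)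
  card_le b _ := (Nat.le_add_right _ _).trans
    ((card_cachedIn_add_evictionsUntil_le C (Nat.zero_le b)).trans
      (Nat.add_le_add_right (hC.card_le b) _))

section CachingCost

variable {M S : Finset α} {p q t : ℕ}

theorem apply_mem_cachedIn (hC : IsSchedule k z C) (t : Fin n) (ha : a ≤ t) :
    z t ∈ cachedIn C a (t + 1) :=
  subset_cachedIn C (Nat.le_succ_of_le ha) (hC.mem t)

theorem card_sdiff_add_cost_le (hcost : IsCachingCost k n d C cost) (hpt : p ≤ t) (ht : t ≤ n)
    (hS : #S = k) (hSM : S ∪ M ⊆ cachedIn C p t) : #(M \ S) + cost p ≤ cost t := by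
  have hle := hcost.card_add_le hpt ht
  have hsub := card_le_card hSM
  have hcard := card_sdiff_add_card M S
  rw [union_comm] at hcard
  omega

/-- The clean requests of the current phase are paid for by the cost since the start `p` of the
previous phase, and those of the next phase by the cost since the start `q` of the current one. So
every unit of the cost is used at most twice. -/
theorem cleanFrom_add_le (hk : 0 < k) (hC : IsSchedule k z C)
    (hcost : IsCachingCost k n d C cost) (ht : t ≤ n) (hpq : p ≤ q) (hqt : q ≤ t) (hS : #S = k)
    (hM : M ⊆ cachedIn C q t) (hSM : S ∪ M ⊆ cachedIn C p t) :
    cleanFrom k z t M S + #(M \ S) + cost p + cost q ≤ 2 * cost n := by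
  induction ht using Nat.decreasingInduction generalizing M S p q with
  | self =>
    have hsdiff := card_sdiff_add_cost_le hcost (hpq.trans hqt) le_rfl hS hSM
    have hq := hcost.mono hqt
    rw [cleanFrom_of_le le_rfl]
    omega
  | of_succ t ht ih =>
    have hz : ∀ ⦃a⦄, a ≤ t → {z ⟨t, ht⟩} ⊆ cachedIn C a (t + 1) := fun a ha =>
      singleton_subset_iff.2 (apply_mem_cachedIn hC ⟨t, ht⟩ ha)
    have hM' := hM.trans (cachedIn_mono C le_rfl (Nat.le_succ t))
    have hSM' := hSM.trans (cachedIn_mono C le_rfl (Nat.le_succ t))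
    have hinsert := ih (S := S) hpq (Nat.le_succ_of_le hqt) hS
      (union_subset (hz hqt) hM') (by
        rw [union_left_comm]; exact union_subset (hz (hpq.trans hqt)) hSM')
    rw [← insert_eq] at hinsert
    rw [cleanFrom_eq ⟨t, ht⟩, Fin.val_mk]
    split_ifs with hzM hMk hclean
    · rwa [insert_eq_of_mem hzM] at hinsert
    · have hsdiff := card_sdiff_add_cost_le hcost (hpq.trans hqt) ht.le hS hSM
      have hnext := ih hqt (Nat.le_succ t) hMk (hz le_rfl) (union_subset hM' (hz hqt))
      rw [sdiff_eq_self_of_disjoint (disjoint_singleton_left.2 hzM), card_singleton] at hnext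
      omega
    · rw [insert_sdiff_of_notMem _ hclean.2, card_insert_of_notMem (by simp [hzM])] at hinsert
      omega
    · have hzS : z ⟨t, ht⟩ ∈ S := by
        by_contra hzS
        exact hclean ⟨card_pos.1 (hS ▸ hk), hzS⟩
      rw [insert_sdiff_of_mem _ hzS] at hinsert
      omega

theorem card_image_le_add_cost (hC : IsSchedule k z C) (hcost : IsCachingCost k n d C cost) :
    #(univ.image z) ≤ d + cost n := by
  refine (card_le_card fun x hx => ?_).trans (hcost.card_le le_rfl)
  obtain ⟨t, -, rfl⟩ := mem_image.1 hx
  exact cachedIn_mono C le_rfl t.2 (apply_mem_cachedIn hC t (Nat.zero_le _))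

theorem cleanFrom_first_phase_add_le (hk : 0 < k) (hC : IsSchedule k z C)
    (hcost : IsCachingCost k n d C cost) (ht : t ≤ n) (hM : M ⊆ cachedIn C 0 t) :
    cleanFrom k z t M ∅ + (min k #(univ.image z) - d) ≤ 2 * cost n := by
  induction ht using Nat.decreasingInduction generalizing M with
  | self =>
    have himage := card_image_le_add_cost hC hcost
    rw [cleanFrom_of_le le_rfl]
    omega
  | of_succ t ht ih =>
    have hz : ∀ ⦃a⦄, a ≤ t → {z ⟨t, ht⟩} ⊆ cachedIn C a (t + 1) := fun a ha =>
      singleton_subset_iff.2 (apply_mem_cachedIn hC ⟨t, ht⟩ ha)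
    have hM' := hM.trans (cachedIn_mono C le_rfl (Nat.le_succ t))
    rw [cleanFrom_eq ⟨t, ht⟩, Fin.val_mk]
    split_ifs with hzM hMk hclean
    · exact ih hM'
    · have hfirst := (card_le_card hM).trans (hcost.card_le ht.le)
      have hnext := cleanFrom_add_le (t := t + 1) hk hC hcost ht (Nat.zero_le t)
        (Nat.le_succ t) hMk (hz le_rfl) (union_subset hM' (hz (Nat.zero_le t)))
      rw [sdiff_eq_self_of_disjoint (disjoint_singleton_left.2 hzM), card_singleton] at hnext
      omega
    · exact absurd hclean.1 not_nonempty_empty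
    · rw [zero_add]
      exact ih (union_subset (hz (Nat.zero_le t)) hM')

end CachingCost

theorem cleanFrom_add_min_le_two_mul_scheduleMisses (hk : 0 < k) (hC : IsSchedule k z C) :
    cleanFrom k z 0 ∅ ∅ + min k #(univ.image z) ≤ 2 * scheduleMisses z C := by
  have hclean := cleanFrom_first_phase_add_le hk hC (isCachingCost_missesUntil hC)
    (Nat.zero_le n) (empty_subset _)
  rwa [missesUntil_eq_scheduleMisses, Nat.sub_zero] at hclean

theorem card_image_le_scheduleMisses (hC : IsSchedule k z C) :
    #(univ.image z) ≤ scheduleMisses z C := by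
  have himage := card_image_le_add_cost hC (isCachingCost_missesUntil hC)
  rwa [missesUntil_eq_scheduleMisses, zero_add] at himage

theorem cleanFrom_le_two_mul_scheduleEvictions (hk : 0 < k) (hC : IsSchedule k z C) :
    cleanFrom k z 0 ∅ ∅ ≤ 2 * scheduleEvictions n C := by
  rw [← evictionsUntil_eq_scheduleEvictions]
  exact (Nat.le_add_right _ _).trans (cleanFrom_first_phase_add_le hk hC
    (isCachingCost_evictionsUntil hC) (Nat.zero_le n) (empty_subset _))

theorem card_image_le_add_scheduleEvictions (hC : IsSchedule k z C) :
    #(univ.image z) ≤ k + scheduleEvictions n C := by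
  rw [← evictionsUntil_eq_scheduleEvictions]
  exact card_image_le_add_cost hC (isCachingCost_evictionsUntil hC)

theorem exists_isSchedule (hk : 0 < k) (z : Fin n → α) : ∃ C, IsSchedule k z C := by
  refine ⟨fun t => ({i : Fin n | i + 1 = t} : Finset (Fin n)).image z, by simp, fun t => ?_,
    fun t => mem_image_of_mem z (by simp), fun t x hx => ?_⟩
  · refine card_image_le.trans ((card_le_one.2 fun i hi j hj => Fin.ext ?_).trans hk)
    exact Nat.succ_injective ((mem_filter.1 hi).2.trans (mem_filter.1 hj).2.symm)
  · obtain ⟨i, hi, rfl⟩ := mem_image.1 hx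
    exact Or.inl (congrArg z (Fin.ext (Nat.succ_injective (mem_filter.1 hi).2)))

theorem exists_optMisses_eq (hk : 0 < k) (z : Fin n → α) :
    ∃ C, IsSchedule k z C ∧ optMisses k z = scheduleMisses z C := by
  obtain ⟨C, hC⟩ := exists_isSchedule hk z
  exact Nat.sInf_mem (s := {m | ∃ C, IsSchedule k z C ∧ m = scheduleMisses z C}) ⟨_, C, hC, rfl⟩

theorem exists_optEvictions_eq (hk : 0 < k) (z : Fin n → α) :
    ∃ C, IsSchedule k z C ∧ optEvictions k z = scheduleEvictions n C := by
  obtain ⟨C, hC⟩ := exists_isSchedule hk z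
  exact Nat.sInf_mem (s := {m | ∃ C, IsSchedule k z C ∧ m = scheduleEvictions n C}) ⟨_, C, hC, rfl⟩

end Offline

/-! ### The competitive ratio -/

section Competitive

variable {α : Type*} {k n : ℕ}

theorem expect_evictions_le_robust (hk : 0 < k) (z : Fin n → α) (h : Fin n → ℝ)
    (tie : Fin n → ℕ) :
    expect (predictiveMarker k z h tie) State.evictions ≤
      ENNReal.ofReal (2 * harmonic k * cleanFrom k z 0 ∅ ∅) := by
  simpa only [robustPotential, add_zero] using
    (robustPotential hk z h tie).expect_evictions_le hk

theorem requestedFrom_zero (z : Fin n → α) : requestedFrom z 0 = univ.image z := by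
  simp [requestedFrom]

theorem openArrivals_zero_subset (z : Fin n → α) (K : Finset (Fin n)) :
    openArrivals z K 0 ∅ ⊆ ({t | t ∉ K ∧ (earlier z t).Nonempty} : Finset (Fin n)) := by
  intro t ht
  obtain ⟨htK, -, ⟨i, -, hit, hzi⟩ | ht⟩ := mem_openArrivals.1 ht
  · exact mem_filter.2 ⟨mem_univ t, htK, i, mem_earlier.2 ⟨hit, hzi⟩⟩
  · exact absurd ht (notMem_empty _)

theorem expect_evictions_le_error (hk : 0 < k) (z : Fin n → α) (h : Fin n → ℝ) {tie : Fin n → ℕ}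
    (htie : Function.Injective tie) :
    expect (predictiveMarker k z h tie) State.evictions ≤
      ENNReal.ofReal (cleanFrom k z 0 ∅ ∅ + (#(univ.image z) - k : ℕ) +
        2 * editError z h tie) := by
  obtain ⟨K, hK, hcard⟩ := exists_strictMonoOn_arrivalKey z h htie
  have hopen := (card_le_card (openArrivals_zero_subset z K)).trans hcard
  refine ((errorPotential hk hK).expect_evictions_le hk).trans (ENNReal.ofReal_le_ofReal ?_)
  simp only [errorPotential, errorBudget, empty_union, requestedFrom_zero, one_mul, add_assoc]
  gcongr

theorem le_ofReal_min_mul {E : ℝ≥0∞} {H : ℝ} {L m d η o : ℕ} (hH : 1 ≤ H)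
    (hrobust : E ≤ ENNReal.ofReal (2 * H * L) + m)
    (herror : E ≤ ENNReal.ofReal (L + d + 2 * η) + m) (hL : L + m ≤ 2 * o) (hd : d + m ≤ o) :
    E ≤ ENNReal.ofReal (min (3 + 2 * ((η : ℝ) / o)) (4 * H) * o) := by
  have hL' : (L : ℝ) + m ≤ 2 * o := by exact_mod_cast hL
  have hd' : (d : ℝ) + m ≤ o := by exact_mod_cast hd
  have hm : (0 : ℝ) ≤ m := Nat.cast_nonneg m
  rw [← ENNReal.ofReal_natCast, ← ENNReal.ofReal_add (by positivity) hm] at hrobust herror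
  have hrobust' : E ≤ ENNReal.ofReal (4 * H * o) :=
    hrobust.trans (ENNReal.ofReal_le_ofReal (by nlinarith))
  rcases o.eq_zero_or_pos with rfl | ho
  · simpa only [Nat.cast_zero, mul_zero] using hrobust'
  rw [min_mul_of_nonneg _ _ (Nat.cast_nonneg o), ENNReal.ofReal_min]
  refine le_min (herror.trans (ENNReal.ofReal_le_ofReal ?_)) hrobust'
  have hη : (3 + 2 * ((η : ℝ) / o)) * o = 3 * o + 2 * η := by field_simp
  linarith

end Competitive

end Caching

end

theorem mainTheorem5 {α : Type*} (k : ℕ) (hk : 0 < k) {n : ℕ} (z : Fin n → α)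
    (h : Fin n → ℝ) (tie : Fin n → ℕ) (htie : Function.Injective tie) :
    Caching.expect (Caching.predictiveMarker k z h tie) Caching.State.misses ≤
        ENNReal.ofReal
          (min (3 + 2 * ((Caching.editError z h tie : ℝ) / (Caching.optMisses k z : ℝ)))
            (4 * (harmonic k : ℝ)) * (Caching.optMisses k z : ℝ)) ∧
      Caching.expect (Caching.predictiveMarker k z h tie) Caching.State.evictions ≤
        ENNReal.ofReal
          (min (3 + 2 * ((Caching.editError z h tie : ℝ) / (Caching.optEvictions k z : ℝ)))
            (4 * (harmonic k : ℝ)) * (Caching.optEvictions k z : ℝ)) := by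
  have hrobust := Caching.expect_evictions_le_robust hk z h tie
  have herror := Caching.expect_evictions_le_error hk z h htie
  have hH := Caching.one_le_harmonic hk
  constructor
  · obtain ⟨C, hC, hopt⟩ := Caching.exists_optMisses_eq hk z
    have hmisses := Caching.expect_misses_le_expect_evictions_add hk z h tie
    have hclean := Caching.cleanFrom_add_min_le_two_mul_scheduleMisses hk hC
    have hrequested := Caching.card_image_le_scheduleMisses hC
    rw [hopt]
    exact Caching.le_ofReal_min_mul hH (hmisses.trans (add_le_add_left hrobust _))
      (hmisses.trans (add_le_add_left herror _)) hclean (by omega)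
  · obtain ⟨C, hC, hopt⟩ := Caching.exists_optEvictions_eq hk z
    have hclean := Caching.cleanFrom_le_two_mul_scheduleEvictions hk hC
    have hrequested := Caching.card_image_le_add_scheduleEvictions hC
    rw [hopt]
    exact Caching.le_ofReal_min_mul (m := 0) hH (hrobust.trans le_self_add)
      (herror.trans le_self_add) hclean (by omega)
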